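/- **Notation.** For a polynomial $p$ of degree $l$ put $p^*(z)=z^l\,\overline{p(1/\bar z)}$. For $0\le k\le n$ and $c_0,\dots,c_k\in\mathbb C$ let $\mathcal Z_n(\varphi;c_0,\dots,c_k)$ be the trigonometric Zolotarev polynomial of degree $n$ with leading coefficients $c_0,\dots,c_k$, that is, the trigonometric polynomial which has least maximum norm on $[0,2\pi]$ among all $\operatorname{Re}\sum_{j=0}^n d_j e^{i(n-j)\varphi}$ with $d_j\in\mathbb C$ and $d_j=c_j$ for $j\le k$. (A minimizer exists, and the statements below hold for every minimizer.) Write $\|\cdot\|$ for the maximum norm on $[0,2\pi]$ and $z=e^{i\varphi}$. **Theorem.** (a) Let $0\le l\le m$, let $p_l(z)=z^l+\dots$ be a monic polynomial of degree $l$ all of whose zeros lie in $|z|<1$, and let $$\frac{p_l(z)}{p_l^*(z)}=\tau_0+\tau_1z+\dots+\tau_mz^m+O(z^{m+1})\qquad(z\to0).$$ Let $r=\max\{|z_j| : p_l(z_j)=0\}$ ($r=0$ if $l=0$) and $\tilde r>r$. Then there is a constant $C$, independent of $n$, such that for all $k=l,\dots,m$, all $n\ge k$ and all $\varphi\in[0,2\pi]$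 $$\Big|\mathcal Z_n(\varphi;\bar\tau_0,\dots,\bar\tau_k)-\operatorname{Re}\Big\{z^n\frac{p_l^*(z)}{p_l(z)}\Big\}\Big|\le C\,\tilde r^{\,n},\qquad \big|\,\|\mathcal Z_n(\cdot\,;\bar\tau_0,\dots,\bar\tau_k)\|-1\big|\le C\,\tilde r^{\,n}.$$ In particular (take $r<\tilde r<1$) the norm tends to $1$ geometrically. (b) More generally, let $0\le l\le m$, let $(n_\nu)$ be a strictly increasing sequence of natural numbers, and let $p_{l,n_\nu}$ be monic polynomials of degree $l$ converging (coefficientwise) to a monic polynomial $p_l$ of degree $l$ which has all its zeros in $|z|\le r$, where $0\le r<1$. Let $$\frac{p_{l,n_\nu}(z)}{p_{l,n_\nu}^*(z)}=\tau_{0,n_\nu}+\dots+\tau_{m,n_\nu}z^m+O(z^{m+1})\qquad(z\to0),$$ let $\delta_\nu$ be the sum of the absolute values of the coefficients of $p_{l,n_\nu}-p_l$, and let $\tilde r>r$. Then there is a constant $C$ such that for all sufficiently large $\nu$, all $k=l,\dots,m$ and all $\varphi\in[0,2\pi]$, with $n=n_\nu$ and $\mathcal Z_n=\mathcal Z_n(\cdot\,;\bar\tau_{0,n},\dots,\bar\tau_{k,n})$,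 $$\Big|\mathcal Z_n(\varphi)-\operatorname{Re}\Big\{z^n\frac{p_{l,n}^*(z)}{p_{l,n}(z)}\Big\}\Big|\le C\,\tilde r^{\,n},\qquad \Big|\mathcal Z_n(\varphi)-\operatorname{Re}\Big\{z^n\frac{p_l^*(z)}{p_l(z)}\Big\}\Big|\le C\,(\tilde r^{\,n}+\delta_\nu),\qquad \big|\,\|\mathcal Z_n\|-1\big|\le C\,\tilde r^{\,n}.$$ -/

import Mathlib

open Filter Topology Asymptotics
open scoped Polynomial

noncomputable section

namespace Zolotarev

/-- The reciprocal polynomial `p^*(z) = z^l * conj (p (1 / conj z))`, where `l` is the degree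
of `p`: the coefficients are conjugated and written in reverse order. -/
def recip (p : ℂ[X]) : ℂ[X] := (p.map (starRingEnd ℂ)).reverse

/-- The point `e^{iφ}` of the unit circle. -/
def circ (φ : ℝ) : ℂ := Complex.exp (φ * Complex.I)

/-- The expansion `p(z) / p^*(z) = τ_0 + τ_1 z + ... + τ_m z^m + O(z^{m+1})` at `z = 0`. -/
def HasExpansion (p : ℂ[X]) (m : ℕ) (τ : ℕ → ℂ) : Prop :=
  (fun z : ℂ => p.eval z / (recip p).eval z - ∑ j ∈ Finset.range (m + 1), τ j * z ^ j)
    =O[𝓝 0] (fun z : ℂ => z ^ (m + 1))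

/-- The real trigonometric polynomial `Re (∑_{j=0}^n c_j e^{i(n-j)φ})`; with `c_j = a_j - i b_j`
this is `∑_{j=0}^n (a_j cos (n-j)φ + b_j sin (n-j)φ)`. -/
def trigPoly (n : ℕ) (c : ℕ → ℂ) (φ : ℝ) : ℝ :=
  (∑ j ∈ Finset.range (n + 1), c j * circ φ ^ (n - j)).re

/-- The maximum norm on `[0, 2π]` (used for continuous functions only). -/
def supNorm (f : ℝ → ℝ) : ℝ :=
  sSup ((fun φ => |f φ|) '' Set.Icc 0 (2 * Real.pi))

/-- `Z` is a trigonometric Zolotarev polynomial of degree `n` with leading coefficients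
`c_0, ..., c_k`: it has least maximum norm among all trigonometric polynomials
`Re (∑_{j=0}^n d_j e^{i(n-j)φ})` with `d_j = c_j` for `j ≤ k`. -/
def IsZolotarev (n k : ℕ) (c : ℕ → ℂ) (Z : ℝ → ℝ) : Prop :=
  (∃ d : ℕ → ℂ, (∀ j ≤ k, d j = c j) ∧ Z = trigPoly n d) ∧
    ∀ d : ℕ → ℂ, (∀ j ≤ k, d j = c j) → supNorm Z ≤ supNorm (trigPoly n d)

/-- The function `Re (z^n p^*(z) / p(z))` at `z = e^{iφ}`. -/
def blaschkeRe (p : ℂ[X]) (n : ℕ) (φ : ℝ) : ℝ :=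
  (circ φ ^ n * ((recip p).eval (circ φ) / p.eval (circ φ))).re

end Zolotarev

end

/-!
On the unit circle `u(z) = z ^ n * p^*(z) / p(z)` (`phase`) is unimodular and
`Re u = Re (z ^ (-n) * p(z) / p^*(z))`. The Taylor coefficients `σ_j` of `p / p^*` decay
geometrically (`exists_taylor`), so the trigonometric polynomial `T` with leading coefficients
`conj σ_j` differs from `Re u` by `O(ρ ^ n)`, for a fixed `ρ` between the moduli of the roots of `p`
and the required rate. As `T` competes in the extremal problem, a minimizer `Z` has norm at most
`1 + O(ρ ^ n)`, and `q = Z - T` is a trigonometric polynomial of degree less than `n - l` such that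
`|Re u + q| ≤ 1 + O(ρ ^ n)`. The heart of the proof is that such a `q` is itself `O(n ρ ^ n)`
(`PhaseSmall.abs_re_sum_le`).

Classically this would be read off from the alternation of `Re u` at the points where `u = ±1`. Here
the point masses at these points are replaced by the Poisson kernels `P_t(u)` and `P_t(-u)` with
`t` close to `1`. Where `P_t(u)` is large, `Re u` is close to `1`, so `q` is almost nonpositive, and
where `P_t(-u)` is large, `q` is almost nonnegative; thus `|q| (P_t(u) + P_t(-u))` is bounded by
`-q (P_t(u) - P_t(-u))` up to small terms (`abs_mul_poisson_le`). The second kernel contains only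
odd powers of `u`. With the weight `|p|²` the first harmonic is exactly orthogonal to `q`, because
`|p|² u = z ^ (n - l) p^*(z)²`; in the higher harmonics the contour is shifted to `|z| = ρ`, where
`|u| = O(ρ ^ n)`. Hence the average of `|p|² |q| (P_t(u) + P_t(-u))` is `O(ρ ^ n)`. The kernel
`P_t(u) + P_t(-u)` contains only even powers of `u`, and testing it against `p² z ^ (-s) q`
recovers, again after a shift of the contour, the coefficients of `p² q` at all exponents `s ≥ 0`
(`PhaseSmall.norm_coeff_sq_mul_le`). Division by `p²`, one root at a time and from the top, is
stable since the roots have modulus less than one, and gives the coefficients of `q`.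

The norm of `Z` cannot be much less than `1` because `|p|² u` has mean value zero, so that `Im u`
vanishes somewhere on the circle and `Re u = ±1` there (`exists_abs_re_phase_eq_one`). All constants
depend only on the degree, on a bound for the roots and on the rate, so that the case of a
convergent sequence of polynomials follows from the continuity of the roots.
-/

namespace Zolotarev

open ComplexConjugate Real

/-! ### Bounds for a polynomial and its reciprocal -/

theorem norm_multiset_prod_le_pow {s : Multiset ℂ} {f : ℂ → ℂ} {M : ℝ}
    (h : ∀ a ∈ s, ‖f a‖ ≤ M) : ‖(s.map f).prod‖ ≤ M ^ s.card := by
  induction s using Multiset.induction with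
  | empty => simp
  | cons a s ih =>
    have h0 : 0 ≤ M := (norm_nonneg _).trans (h a (by simp))
    simp only [Multiset.map_cons, Multiset.prod_cons, Multiset.card_cons, norm_mul, pow_succ']
    exact mul_le_mul (h a (by simp)) (ih fun b hb => h b (by simp [hb])) (norm_nonneg _) h0

theorem pow_le_norm_multiset_prod {s : Multiset ℂ} {f : ℂ → ℂ} {M : ℝ} (hM : 0 ≤ M)
    (h : ∀ a ∈ s, M ≤ ‖f a‖) : M ^ s.card ≤ ‖(s.map f).prod‖ := by
  induction s using Multiset.induction with
  | empty => simp
  | cons a s ih =>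
    simp only [Multiset.map_cons, Multiset.prod_cons, Multiset.card_cons, norm_mul, pow_succ']
    exact mul_le_mul (h a (by simp)) (ih fun b hb => h b (by simp [hb])) (by positivity)
      (norm_nonneg _)

section Bounds

variable {p : ℂ[X]} {r : ℝ}

theorem card_roots_eq_natDegree (p : ℂ[X]) : p.roots.card = p.natDegree :=
  (IsAlgClosed.splits p).natDegree_eq_card_roots.symm

theorem norm_le_of_mem_roots (hr : ∀ z, p.IsRoot z → ‖z‖ ≤ r) {a : ℂ} (ha : a ∈ p.roots) :
    ‖a‖ ≤ r :=
  hr a (Polynomial.isRoot_of_mem_roots ha)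

theorem norm_eval_le (hp : p.Monic) (hr : ∀ z, p.IsRoot z → ‖z‖ ≤ r) (z : ℂ) :
    ‖p.eval z‖ ≤ (‖z‖ + r) ^ p.natDegree := by
  rw [(IsAlgClosed.splits p).eval_eq_prod_roots_of_monic hp, ← card_roots_eq_natDegree]
  refine norm_multiset_prod_le_pow fun a ha => (norm_sub_le _ _).trans ?_
  linarith [norm_le_of_mem_roots hr ha]

theorem le_norm_eval (hp : p.Monic) (hr : ∀ z, p.IsRoot z → ‖z‖ ≤ r) {z : ℂ} (hz : r ≤ ‖z‖) :
    (‖z‖ - r) ^ p.natDegree ≤ ‖p.eval z‖ := by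
  rw [(IsAlgClosed.splits p).eval_eq_prod_roots_of_monic hp, ← card_roots_eq_natDegree]
  refine pow_le_norm_multiset_prod (by linarith) fun a ha => ?_
  linarith [norm_le_of_mem_roots hr ha, norm_sub_norm_le z a]

theorem recip_eval_of_ne_zero (p : ℂ[X]) {z : ℂ} (hz : z ≠ 0) :
    (recip p).eval z = z ^ p.natDegree * conj (p.eval (conj z)⁻¹) := by
  have hdeg : (p.map (starRingEnd ℂ)).natDegree = p.natDegree :=
    Polynomial.natDegree_map_eq_of_injective (starRingEnd ℂ).injective p
  have : Invertible z⁻¹ := invertibleOfNonzero (inv_ne_zero hz)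
  have h := Polynomial.eval₂_reverse_mul_pow (RingHom.id ℂ) z⁻¹ (p.map (starRingEnd ℂ))
  rw [invOf_eq_inv, inv_inv, hdeg] at h
  have h2 : Polynomial.eval₂ (RingHom.id ℂ) z⁻¹ (p.map (starRingEnd ℂ))
      = conj (p.eval (conj z)⁻¹) := by
    rw [← Polynomial.eval₂_at_apply, Polynomial.eval₂_map]
    simp
  rw [h2] at h
  rw [← h, Polynomial.eval, recip, inv_pow]
  field_simp

theorem recip_eval_zero (hp : p.Monic) : (recip p).eval 0 = 1 := by
  rw [← Polynomial.coeff_zero_eq_eval_zero, recip, Polynomial.coeff_zero_reverse]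
  exact (hp.map _).leadingCoeff

theorem recip_eval_of_norm_eq_one (p : ℂ[X]) {z : ℂ} (hz : ‖z‖ = 1) :
    (recip p).eval z = z ^ p.natDegree * conj (p.eval z) := by
  have h0 : z ≠ 0 := by rintro rfl; simp at hz
  rw [recip_eval_of_ne_zero p h0]
  have h1 : (conj z)⁻¹ = z := by
    rw [Complex.inv_def, Complex.conj_conj, Complex.normSq_conj, Complex.normSq_eq_norm_sq, hz]
    simp
  rw [h1]

theorem norm_recip_eval_le (hp : p.Monic) (hr : ∀ z, p.IsRoot z → ‖z‖ ≤ r) (z : ℂ) :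
    ‖(recip p).eval z‖ ≤ (1 + r * ‖z‖) ^ p.natDegree := by
  rcases eq_or_ne z 0 with rfl | hz
  · simp [recip_eval_zero hp]
  · rw [recip_eval_of_ne_zero p hz, norm_mul, norm_pow, Complex.norm_conj]
    refine (mul_le_mul_of_nonneg_left (norm_eval_le hp hr _) (by positivity)).trans (le_of_eq ?_)
    rw [← mul_pow, norm_inv, Complex.norm_conj]
    have := norm_ne_zero_iff.2 hz
    field_simp

theorem le_norm_recip_eval (hp : p.Monic) (hr : ∀ z, p.IsRoot z → ‖z‖ ≤ r) {z : ℂ}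
    (hz : r * ‖z‖ ≤ 1) : (1 - r * ‖z‖) ^ p.natDegree ≤ ‖(recip p).eval z‖ := by
  rcases eq_or_ne z 0 with rfl | h0
  · simp [recip_eval_zero hp]
  · have hn := norm_pos_iff.2 h0
    rw [recip_eval_of_ne_zero p h0, norm_mul, norm_pow, Complex.norm_conj]
    have h1 : r ≤ ‖(conj z)⁻¹‖ := by
      rw [norm_inv, Complex.norm_conj, ← one_div, le_div_iff₀ hn]; exact hz
    refine le_trans (le_of_eq ?_)
      (mul_le_mul_of_nonneg_left (le_norm_eval hp hr h1) (by positivity))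
    rw [← mul_pow, norm_inv, Complex.norm_conj]
    field_simp

theorem eval_ne_zero_of_lt (hr : ∀ z, p.IsRoot z → ‖z‖ ≤ r) {z : ℂ} (hz : r < ‖z‖) :
    p.eval z ≠ 0 := fun h => absurd (hr z h) (not_le.2 hz)

theorem recip_eval_ne_zero (hp : p.Monic) (hr : ∀ z, p.IsRoot z → ‖z‖ ≤ r) {z : ℂ}
    (hz : r * ‖z‖ < 1) : (recip p).eval z ≠ 0 := by
  have h := le_norm_recip_eval hp hr hz.le
  have : 0 < (1 - r * ‖z‖) ^ p.natDegree := pow_pos (by linarith) _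
  exact norm_pos_iff.1 (this.trans_le h)

theorem normSq_eval_eq (p : ℂ[X]) {z : ℂ} (hz : ‖z‖ = 1) :
    ((‖p.eval z‖ ^ 2 : ℝ) : ℂ) = p.eval z * (recip p).eval z * (z ^ p.natDegree)⁻¹ := by
  have h0 : z ≠ 0 := by rintro rfl; simp at hz
  rw [recip_eval_of_norm_eq_one p hz]
  push_cast
  rw [← Complex.mul_conj']
  field_simp

end Bounds

/-- The function `z ^ n * p^*(z) / p(z)`, unimodular on the unit circle. -/
noncomputable def phase (p : ℂ[X]) (n : ℕ) (z : ℂ) : ℂ :=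
  z ^ n * ((recip p).eval z / p.eval z)

theorem blaschkeRe_eq (p : ℂ[X]) (n : ℕ) (φ : ℝ) :
    blaschkeRe p n φ = (phase p n (circ φ)).re := rfl

section Phase

variable {p : ℂ[X]} {r ρ : ℝ}

theorem norm_phase_of_norm_eq_one (hr : ∀ z, p.IsRoot z → ‖z‖ ≤ r) (hr1 : r < 1) (n : ℕ) {z : ℂ}
    (hz : ‖z‖ = 1) : ‖phase p n z‖ = 1 := by
  have h0 : p.eval z ≠ 0 := eval_ne_zero_of_lt hr (by rw [hz]; exact hr1)
  rw [phase, norm_mul, norm_div, recip_eval_of_norm_eq_one p hz, norm_mul, norm_pow, norm_pow, hz,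
    Complex.norm_conj, one_pow, one_pow, one_mul, one_mul, div_self (norm_ne_zero_iff.2 h0)]

theorem norm_phase_le_of_norm_eq (hp : p.Monic) (hr : ∀ z, p.IsRoot z → ‖z‖ ≤ r) (hr0 : 0 ≤ r)
    (hrρ : r < ρ) (hρ : ρ < 1) (n : ℕ) {z : ℂ} (hz : ‖z‖ = ρ) :
    ‖phase p n z‖ ≤ (2 / (ρ - r)) ^ p.natDegree * ρ ^ n := by
  rw [phase, norm_mul, norm_div, norm_pow, hz, mul_comm, div_pow]
  have h1 := norm_recip_eval_le hp hr z
  have h2 := le_norm_eval hp hr (z := z) (by rw [hz]; exact hrρ.le)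
  rw [hz] at h1 h2
  have h3 : 0 < (ρ - r) ^ p.natDegree := pow_pos (by linarith) _
  have h4 : (1 + r * ρ) ^ p.natDegree ≤ 2 ^ p.natDegree := by
    have : r * ρ ≤ 1 := by nlinarith
    gcongr
    · nlinarith
    · linarith
  have : 0 ≤ ρ := by linarith
  gcongr
  exact h1.trans h4

theorem differentiableAt_phase (hr : ∀ z, p.IsRoot z → ‖z‖ ≤ r) (n : ℕ) {z : ℂ} (hz : r < ‖z‖) :
    DifferentiableAt ℂ (phase p n) z := by
  unfold phase
  exact (differentiableAt_id.pow n).mul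
    (((recip p).differentiable z).div (p.differentiable z) (eval_ne_zero_of_lt hr hz))

/-- The maximum principle on the annulus `ρ ≤ |z| ≤ 1`. -/
theorem norm_phase_le_one (hp : p.Monic) (hr : ∀ z, p.IsRoot z → ‖z‖ ≤ r) (hr0 : 0 ≤ r)
    (hrρ : r < ρ) (hρ : ρ < 1) {n : ℕ} (hn : (2 / (ρ - r)) ^ p.natDegree * ρ ^ n ≤ 1) {z : ℂ}
    (hz1 : ρ ≤ ‖z‖) (hz2 : ‖z‖ ≤ 1) : ‖phase p n z‖ ≤ 1 := by
  rcases hz1.eq_or_lt with h | h1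
  · exact (norm_phase_le_of_norm_eq hp hr hr0 hrρ hρ n h.symm).trans hn
  rcases hz2.eq_or_lt with h | h2
  · exact (norm_phase_of_norm_eq_one hr (hrρ.trans hρ) n h).le
  set U : Set ℂ := {w | ρ < ‖w‖ ∧ ‖w‖ < 1} with hU
  have hcl : closure U ⊆ {w | ρ ≤ ‖w‖ ∧ ‖w‖ ≤ 1} := by
    refine closure_minimal (fun w hw => ⟨hw.1.le, hw.2.le⟩) ?_
    exact (isClosed_le continuous_const continuous_norm).inter
      (isClosed_le continuous_norm continuous_const)
  have hopen : IsOpen U := (isOpen_lt continuous_const continuous_norm).inter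
      (isOpen_lt continuous_norm continuous_const)
  refine Complex.norm_le_of_forall_mem_frontier_norm_le (U := U) ?_ ?_ ?_
    (subset_closure ⟨h1, h2⟩)
  · exact (Metric.isBounded_ball (x := (0 : ℂ)) (r := 1)).subset fun w hw => by simpa using hw.2
  · refine DifferentiableOn.diffContOnCl fun w hw => ?_
    exact (differentiableAt_phase hr n (hrρ.trans_le (hcl hw).1)).differentiableWithinAt
  · intro w hw
    have hw1 := hcl hw.1
    have hw2 : w ∉ U := by rw [← hopen.interior_eq]; exact hw.2
    rcases hw1.1.eq_or_lt with h | h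
    · exact (norm_phase_le_of_norm_eq hp hr hr0 hrρ hρ n h.symm).trans hn
    rcases hw1.2.eq_or_lt with h' | h'
    · exact (norm_phase_of_norm_eq_one hr (hrρ.trans hρ) n h').le
    · exact absurd ⟨h, h'⟩ hw2

end Phase

/-! ### Averages over circles -/

theorem norm_circleAverage_le {f : ℂ → ℂ} {R B : ℝ} (hR : 0 ≤ R)
    (h : ∀ z, ‖z‖ = R → ‖f z‖ ≤ B) : ‖circleAverage f 0 R‖ ≤ B := by
  have h1 : ‖∫ θ in (0 : ℝ)..2 * π, f (circleMap 0 R θ)‖ ≤ B * |2 * π - 0| :=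
    intervalIntegral.norm_integral_le_of_norm_le_const fun θ _ =>
      h _ (by simp [abs_of_nonneg hR])
  have hpi : 0 < 2 * π := by positivity
  rw [circleAverage_def, norm_smul, norm_inv, Real.norm_of_nonneg hpi.le]
  rw [sub_zero, abs_of_pos hpi] at h1
  rw [inv_mul_le_iff₀ hpi]
  linarith

theorem norm_circleAverage_le_circleAverage_norm (f : ℂ → ℂ) :
    ‖circleAverage f 0 1‖ ≤ circleAverage (fun z => ‖f z‖) 0 1 := by
  have hpi : 0 < 2 * π := by positivity
  rw [circleAverage_def, circleAverage_def, norm_smul, norm_inv, Real.norm_of_nonneg hpi.le,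
    smul_eq_mul]
  gcongr
  exact intervalIntegral.norm_integral_le_integral_norm hpi.le

theorem circleAverage_congr {E : Type*} [NormedAddCommGroup E] [NormedSpace ℝ E] {f g : ℂ → E}
    (h : ∀ z, ‖z‖ = 1 → f z = g z) : circleAverage f 0 1 = circleAverage g 0 1 :=
  circleAverage_congr_sphere fun z hz => h z (by simpa using hz)

/-- Averages of holomorphic functions over concentric circles agree. -/
theorem circleAverage_eq_of_annulus {g : ℂ → ℂ} {ρ : ℝ} (hρ0 : 0 < ρ) (hρ : ρ ≤ 1)
    (hg : ∀ z, ρ ≤ ‖z‖ → ‖z‖ ≤ 1 → DifferentiableAt ℂ g z) :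
    circleAverage g 0 1 = circleAverage g 0 ρ := by
  rw [circleAverage_eq_circleIntegral one_ne_zero, circleAverage_eq_circleIntegral hρ0.ne',
    Complex.circleIntegral_sub_center_inv_smul_eq_of_differentiable_on_annulus_off_countable hρ0 hρ
      Set.countable_empty]
  · intro z hz
    simp only [Set.mem_sdiff, Metric.mem_closedBall, dist_zero_right, Metric.mem_ball, not_lt] at hz
    exact (hg z hz.2 hz.1).continuousAt.continuousWithinAt
  · intro z hz
    simp only [Set.mem_sdiff, Metric.mem_closedBall, dist_zero_right, Metric.mem_ball, not_le] at hz
    exact hg z hz.1.2.le hz.1.1.le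

theorem norm_circleAverage_le_of_annulus {f g : ℂ → ℂ} {ρ B : ℝ} (hρ0 : 0 < ρ) (hρ : ρ ≤ 1)
    (hfg : ∀ z, ‖z‖ = 1 → f z = g z)
    (hg : ∀ z, ρ ≤ ‖z‖ → ‖z‖ ≤ 1 → DifferentiableAt ℂ g z) (hB : ∀ z, ‖z‖ = ρ → ‖g z‖ ≤ B) :
    ‖circleAverage f 0 1‖ ≤ B := by
  rw [circleAverage_congr hfg, circleAverage_eq_of_annulus hρ0 hρ hg]
  exact norm_circleAverage_le hρ0.le hB

theorem circleAverage_zpow (k : ℤ) :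
    circleAverage (fun z : ℂ => z ^ k) 0 1 = if k = 0 then 1 else 0 := by
  have hpi : (2 * (π : ℂ) * Complex.I) ≠ 0 := by simp [Real.pi_ne_zero]
  rw [circleAverage_eq_circleIntegral one_ne_zero]
  have h : (∮ z in C(0, 1), (z - 0)⁻¹ • z ^ k) = ∮ z in C(0, 1), (z - 0 : ℂ) ^ (k - 1) := by
    refine circleIntegral.integral_congr zero_le_one fun z hz => ?_
    have hz0 : z ≠ 0 := by rintro rfl; simp at hz
    simp only [sub_zero, smul_eq_mul]
    rw [zpow_sub_one₀ hz0, mul_comm]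
  rw [h]
  split_ifs with hk
  · subst hk
    have := circleIntegral.integral_sub_center_inv (0 : ℂ) (R := 1) one_ne_zero
    simp only [zero_sub, zpow_neg_one, this, smul_eq_mul]
    exact inv_mul_cancel₀ hpi
  · rw [circleIntegral.integral_sub_zpow_of_ne (by omega), smul_zero]

theorem circleAverage_eval_mul_inv_pow (A : ℂ[X]) (j : ℕ) :
    circleAverage (fun z : ℂ => A.eval z * (z ^ j)⁻¹) 0 1 = A.coeff j := by
  have h : ∀ z : ℂ, ‖z‖ = 1 → A.eval z * (z ^ j)⁻¹
      = ∑ i ∈ Finset.range (A.natDegree + 1), A.coeff i • z ^ ((i : ℤ) - j) := by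
    intro z hz
    have hz0 : z ≠ 0 := by rintro rfl; simp at hz
    rw [Polynomial.eval_eq_sum_range, Finset.sum_mul]
    refine Finset.sum_congr rfl fun i _ => ?_
    rw [zpow_sub₀ hz0, smul_eq_mul, zpow_natCast, zpow_natCast]
    ring
  rw [circleAverage_congr h, circleAverage_fun_sum]
  · simp_rw [circleAverage_fun_smul, circleAverage_zpow]
    simp only [sub_eq_zero, Nat.cast_inj, smul_eq_mul, mul_ite, mul_one, mul_zero,
      Finset.sum_ite_eq', Finset.mem_range]
    split_ifs with h
    · rfl
    · exact (Polynomial.coeff_eq_zero_of_natDegree_lt (by omega)).symm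
  · intro i _
    refine ContinuousOn.circleIntegrable zero_le_one fun z hz => ?_
    have hz0 : z ≠ 0 := by rintro rfl; simp at hz
    simp only [smul_eq_mul]
    exact (continuousAt_const.mul (continuousAt_zpow₀ z _ (Or.inl hz0))).continuousWithinAt

theorem circleAverage_conj (f : ℂ → ℂ) :
    circleAverage (fun z => conj (f z)) 0 1 = conj (circleAverage f 0 1) := by
  simp only [circleAverage_def, Complex.real_smul, map_mul, Complex.conj_ofReal]
  congr 1
  simp only [intervalIntegral.integral_of_le (by positivity : (0 : ℝ) ≤ 2 * π)]
  exact integral_conj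

theorem circleAverage_re {f : ℂ → ℂ} (hf : CircleIntegrable f 0 1) :
    circleAverage (fun z => (f z).re) 0 1 = (circleAverage f 0 1).re :=
  Complex.reCLM.circleAverage_comp_comm hf

/-- The maximum principle for polynomials on the unit disc. -/
theorem norm_eval_le_of_norm_le_one {A : ℂ[X]} {M : ℝ} (h : ∀ z, ‖z‖ = 1 → ‖A.eval z‖ ≤ M) {z : ℂ}
    (hz : ‖z‖ ≤ 1) : ‖A.eval z‖ ≤ M := by
  refine Complex.norm_le_of_forall_mem_frontier_norm_le (U := Metric.ball (0 : ℂ) 1)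
    Metric.isBounded_ball (f := fun z => A.eval z) A.differentiable.diffContOnCl ?_ ?_
  · intro w hw
    rw [frontier_ball _ one_ne_zero] at hw
    exact h w (by simpa using hw)
  · rw [closure_ball _ one_ne_zero]
    simpa using hz

/-- The contour is shifted after removing a polynomial that vanishes at the origin. -/
theorem norm_circleAverage_le_of_annulus_add {f g : ℂ → ℂ} {ρ B : ℝ} (hρ0 : 0 < ρ) (hρ : ρ ≤ 1)
    (A : ℂ[X]) (hA : A.coeff 0 = 0) (hfg : ∀ z, ‖z‖ = 1 → f z = A.eval z + g z)
    (hg : ∀ z, ρ ≤ ‖z‖ → ‖z‖ ≤ 1 → DifferentiableAt ℂ g z) (hB : ∀ z, ‖z‖ = ρ → ‖g z‖ ≤ B) :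
    ‖circleAverage f 0 1‖ ≤ B := by
  have h1 : CircleIntegrable (fun z => A.eval z) 0 1 :=
    A.continuous.continuousOn.circleIntegrable zero_le_one
  have h2 : CircleIntegrable g 0 1 :=
    ContinuousOn.circleIntegrable zero_le_one fun z hz =>
      (hg z (by simpa [mem_sphere_zero_iff_norm.1 hz] using hρ)
        (mem_sphere_zero_iff_norm.1 hz).le).continuousAt.continuousWithinAt
  have h3 : circleAverage (fun z => A.eval z) 0 1 = 0 := by
    simpa [hA] using circleAverage_eval_mul_inv_pow A 0
  rw [circleAverage_congr hfg, circleAverage_fun_add h1 h2, h3, zero_add,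
    circleAverage_eq_of_annulus hρ0 hρ hg]
  exact norm_circleAverage_le hρ0.le hB

theorem circleIntegrable_of_continuousAt {E : Type*} [NormedAddCommGroup E] {f : ℂ → E}
    (h : ∀ z, ‖z‖ = 1 → ContinuousAt f z) : CircleIntegrable f 0 1 :=
  ContinuousOn.circleIntegrable zero_le_one fun z hz =>
    (h z (mem_sphere_zero_iff_norm.1 hz)).continuousWithinAt

theorem circleAverage_linear_combination {E : Type*} [NormedAddCommGroup E] [NormedSpace ℝ E]
    (a b c : ℝ) {f g h : ℂ → E} (hf : CircleIntegrable f 0 1) (hg : CircleIntegrable g 0 1)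
    (hh : CircleIntegrable h 0 1) :
    circleAverage (fun z => a • f z + b • g z + c • h z) 0 1
      = a • circleAverage f 0 1 + b • circleAverage g 0 1 + c • circleAverage h 0 1 := by
  have h1 : CircleIntegrable (fun z => a • f z) 0 1 := IntervalIntegrable.smul hf a
  have h2 : CircleIntegrable (fun z => b • g z) 0 1 := IntervalIntegrable.smul hg b
  have h3 : CircleIntegrable (fun z => c • h z) 0 1 := IntervalIntegrable.smul hh c
  have h4 : CircleIntegrable (fun z => a • f z + b • g z) 0 1 := h1.add h2
  rw [circleAverage_fun_add h4 h3, circleAverage_fun_add h1 h2, circleAverage_fun_smul,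
    circleAverage_fun_smul, circleAverage_fun_smul]

/-! ### Poisson kernels -/

theorem eq_ofReal_re {w : ℂ} (h : w.im = 0) : w = (w.re : ℂ) :=
  Complex.ext rfl (by simp [h])

section Kernel

variable {u : ℂ} {t : ℝ}

theorem norm_one_sub_sq (hu : ‖u‖ = 1) : ‖1 - t * u‖ ^ 2 = 1 - 2 * t * u.re + t ^ 2 := by
  have h : u.re * u.re + u.im * u.im = 1 := by
    rw [← Complex.normSq_apply, Complex.normSq_eq_norm_sq, hu, one_pow]
  rw [← Complex.normSq_eq_norm_sq, Complex.normSq_apply]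
  simp
  linear_combination t ^ 2 * h

theorem norm_one_add_sq (hu : ‖u‖ = 1) : ‖1 + t * u‖ ^ 2 = 1 + 2 * t * u.re + t ^ 2 := by
  have := norm_one_sub_sq (u := -u) (t := t) (by rwa [norm_neg])
  simp only [mul_neg, sub_neg_eq_add, Complex.neg_re] at this
  exact this

/-- The Poisson kernel `(1 - t²) / |1 - t u|²`, for `|u| = 1`. -/
noncomputable def poisson (t : ℝ) (u : ℂ) : ℝ := (1 - t ^ 2) / ‖1 - t * u‖ ^ 2

theorem poisson_nonneg (ht0 : 0 < t) (ht1 : t < 1) : 0 ≤ poisson t u :=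
  div_nonneg (by nlinarith) (by positivity)

theorem abs_re_le_one (hu : ‖u‖ = 1) : -1 ≤ u.re ∧ u.re ≤ 1 :=
  abs_le.1 ((Complex.abs_re_le_norm u).trans hu.le)

/-- The Poisson kernel concentrates at `u = 1`: this bound tends to `0` as `t → 1`. -/
theorem one_sub_re_mul_poisson_le (ht0 : 0 < t) (ht1 : t < 1) (hu : ‖u‖ = 1) :
    (1 - u.re) * poisson t u ≤ (1 - t ^ 2) / (2 * t) := by
  have h1 := abs_re_le_one hu
  rw [poisson, norm_one_sub_sq hu, ← mul_div_assoc, div_le_div_iff₀ (by nlinarith) (by positivity)]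
  have h2 : 0 < 1 - t ^ 2 := by nlinarith
  nlinarith [mul_nonneg h2.le (sq_nonneg (1 - t))]

theorem one_sub_sq_mul_sq_ne_zero {u : ℂ} (ht0 : 0 < t) (ht1 : t < 1) (hu : ‖u‖ ≤ 1) :
    1 - (t : ℂ) ^ 2 * u ^ 2 ≠ 0 := by
  intro h
  have h1 : ‖(t : ℂ) ^ 2 * u ^ 2‖ = 1 := by rw [← sub_eq_zero.1 h, norm_one]
  rw [norm_mul, norm_pow, norm_pow, Complex.norm_real, Real.norm_of_nonneg ht0.le] at h1
  nlinarith [norm_nonneg u, pow_le_one₀ (n := 2) (norm_nonneg u) hu]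

theorem normSq_one_sub_sq_mul_sq (hu : ‖u‖ = 1) :
    Complex.normSq (1 - (t : ℂ) ^ 2 * u ^ 2)
      = (1 - 2 * t * u.re + t ^ 2) * (1 + 2 * t * u.re + t ^ 2) := by
  rw [← norm_one_sub_sq hu, ← norm_one_add_sq hu, ← _root_.mul_pow ‖_‖, ← norm_mul,
    Complex.normSq_eq_norm_sq]
  congr 2
  ring

theorem im_sq_eq (hu : ‖u‖ = 1) : u.im ^ 2 = 1 - u.re ^ 2 := by
  have : u.re * u.re + u.im * u.im = 1 := by
    rw [← Complex.normSq_apply, Complex.normSq_eq_norm_sq, hu, one_pow]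
  linarith

theorem poisson_add_poisson_neg (ht0 : 0 < t) (ht1 : t < 1) (hu : ‖u‖ = 1) :
    poisson t u + poisson t (-u)
      = 2 + 4 * ((t : ℂ) ^ 2 * u ^ 2 / (1 - (t : ℂ) ^ 2 * u ^ 2)).re := by
  have h1 := abs_re_le_one hu
  have ha : 1 - 2 * t * u.re + t ^ 2 ≠ 0 := by nlinarith
  have hb : 1 + 2 * t * u.re + t ^ 2 ≠ 0 := by nlinarith
  have key : ((t : ℂ) ^ 2 * u ^ 2 / (1 - (t : ℂ) ^ 2 * u ^ 2)).re
      = (t ^ 2 * (2 * u.re ^ 2 - 1) - t ^ 4)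
        / ((1 - 2 * t * u.re + t ^ 2) * (1 + 2 * t * u.re + t ^ 2)) := by
    rw [Complex.div_re, normSq_one_sub_sq_mul_sq hu, ← add_div]
    congr 1
    simp [pow_two]
    ring_nf
    simp only [show u.im ^ 4 = (u.im ^ 2) ^ 2 by ring, im_sq_eq hu]
    ring
  rw [key, poisson, poisson, norm_one_sub_sq hu, mul_neg, sub_neg_eq_add, norm_one_add_sq hu,
    div_add_div _ _ ha hb, div_eq_iff (mul_ne_zero ha hb), add_mul _ (4 * _), mul_assoc 4,
    div_mul_cancel₀ _ (mul_ne_zero ha hb)]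
  ring

theorem poisson_sub_poisson_neg (ht0 : 0 < t) (ht1 : t < 1) (hu : ‖u‖ = 1) :
    poisson t u - poisson t (-u) = 4 * ((t : ℂ) * u / (1 - (t : ℂ) ^ 2 * u ^ 2)).re := by
  have h1 := abs_re_le_one hu
  have ha : 1 - 2 * t * u.re + t ^ 2 ≠ 0 := by nlinarith
  have hb : 1 + 2 * t * u.re + t ^ 2 ≠ 0 := by nlinarith
  have key : ((t : ℂ) * u / (1 - (t : ℂ) ^ 2 * u ^ 2)).re
      = (t * u.re * (1 - t ^ 2))
        / ((1 - 2 * t * u.re + t ^ 2) * (1 + 2 * t * u.re + t ^ 2)) := by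
    rw [Complex.div_re, normSq_one_sub_sq_mul_sq hu, ← add_div]
    congr 1
    simp [pow_two]
    ring_nf
    simp only [im_sq_eq hu]
    ring
  rw [key, poisson, poisson, norm_one_sub_sq hu, mul_neg, sub_neg_eq_add, norm_one_add_sq hu,
    div_sub_div _ _ ha hb, div_eq_iff (mul_ne_zero ha hb), mul_assoc 4,
    div_mul_cancel₀ _ (mul_ne_zero ha hb)]
  ring

/-- The analytic half `w / (1 - w)`, `w = t² u²`, of the sum of the two Poisson kernels. -/
noncomputable def geom (t : ℝ) (u : ℂ) : ℂ := (t : ℂ) ^ 2 * u ^ 2 / (1 - (t : ℂ) ^ 2 * u ^ 2)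

theorem continuousAt_poisson (ht0 : 0 < t) (ht1 : t < 1) {f : ℂ → ℂ} {z : ℂ}
    (hf : ContinuousAt f z) (hz : ‖f z‖ = 1) : ContinuousAt (fun z => poisson t (f z)) z := by
  have h1 := abs_re_le_one hz
  refine continuousAt_const.div
    (((continuousAt_const.sub (continuousAt_const.mul hf)).norm).pow 2) ?_
  change ‖1 - (t : ℂ) * f z‖ ^ 2 ≠ 0
  rw [norm_one_sub_sq hz]
  nlinarith

/-- If `Re u + q` stays in `[-1 - ε, 1 + ε]`, then `q` is nearly of one sign where `u` is close to
`1`, and of the other sign where `u` is close to `-1`. -/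
theorem abs_mul_poisson_le (ht0 : 0 < t) (ht1 : t < 1) (hu : ‖u‖ = 1) {q ε : ℝ} (hε : 0 ≤ ε)
    (h : |u.re + q| ≤ 1 + ε) :
    |q| * (poisson t u + poisson t (-u)) ≤ -(q * (poisson t u - poisson t (-u)))
      + 2 * ε * (poisson t u + poisson t (-u)) + 2 * ((1 - t ^ 2) / t) := by
  have h1 := abs_re_le_one hu
  have hP := poisson_nonneg (u := u) ht0 ht1
  have hQ := poisson_nonneg (u := -u) ht0 ht1
  have k1 := one_sub_re_mul_poisson_le ht0 ht1 hu
  have k2 := one_sub_re_mul_poisson_le (u := -u) ht0 ht1 (by rwa [norm_neg])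
  have k3 : (1 - t ^ 2) / t = 2 * ((1 - t ^ 2) / (2 * t)) := by field_simp
  have h2 := abs_le.1 h
  rw [k3]
  simp only [Complex.neg_re] at k2
  have m1 : |q| + q ≤ 2 * (ε + (1 - u.re)) := by
    rcases abs_cases q with hq | hq <;> linarith
  have m2 : |q| - q ≤ 2 * (ε + (1 - -u.re)) := by
    rcases abs_cases q with hq | hq <;> linarith
  nlinarith [mul_le_mul_of_nonneg_right m1 hP, mul_le_mul_of_nonneg_right m2 hQ]

end Kernel

/-! ### Shifting the contour -/

/-- A factor `C` for which the shifted contour integrals over `|z| = ρ` are at most `C * ρ ^ n`;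
it depends only on the degree `l`, the bound `r` for the roots and the radius `ρ`. -/
noncomputable def errConst (l : ℕ) (r ρ : ℝ) : ℝ :=
  6 * 4 ^ l * (ρ⁻¹) ^ (2 * l) * ((2 / (ρ - r)) ^ l) ^ 2

/-- The roots of the monic polynomial `p` lie in `|z| ≤ r`, and `n` is so large that the bound
`(2 / (ρ - r)) ^ l * ρ ^ n` for `|z ^ n p^*(z) / p(z)|` on the circle `|z| = ρ` is at most
`1 / 2`. -/
structure PhaseSmall (p : ℂ[X]) (r ρ : ℝ) (n : ℕ) : Prop where
  monic : p.Monic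
  roots : ∀ z, p.IsRoot z → ‖z‖ ≤ r
  nonneg : 0 ≤ r
  lt : r < ρ
  lt_one : ρ < 1
  small : (2 / (ρ - r)) ^ p.natDegree * ρ ^ n ≤ 1 / 2

namespace PhaseSmall

variable {p : ℂ[X]} {r ρ : ℝ} {n : ℕ}

theorem pos (d : PhaseSmall p r ρ n) : 0 < ρ := d.nonneg.trans_lt d.lt

theorem ne_zero (d : PhaseSmall p r ρ n) {z : ℂ} (hz : ρ ≤ ‖z‖) : z ≠ 0 :=
  norm_pos_iff.1 (d.pos.trans_le hz)

theorem norm_phase (d : PhaseSmall p r ρ n) {z : ℂ} (hz : ‖z‖ = 1) : ‖phase p n z‖ = 1 :=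
  norm_phase_of_norm_eq_one d.roots (d.lt.trans d.lt_one) n hz

theorem norm_phase_le (d : PhaseSmall p r ρ n) {z : ℂ} (hz : ‖z‖ = ρ) :
    ‖phase p n z‖ ≤ (2 / (ρ - r)) ^ p.natDegree * ρ ^ n :=
  norm_phase_le_of_norm_eq d.monic d.roots d.nonneg d.lt d.lt_one n hz

theorem one_sub_ne_zero (d : PhaseSmall p r ρ n) {t : ℝ} (ht0 : 0 < t) (ht1 : t < 1) {z : ℂ}
    (hz1 : ρ ≤ ‖z‖) (hz2 : ‖z‖ ≤ 1) : 1 - (t : ℂ) ^ 2 * phase p n z ^ 2 ≠ 0 :=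
  one_sub_sq_mul_sq_ne_zero ht0 ht1 (norm_phase_le_one d.monic d.roots d.nonneg d.lt d.lt_one
    (d.small.trans (by norm_num)) hz1 hz2)

theorem differentiableAt_geom (d : PhaseSmall p r ρ n) {t : ℝ} (ht0 : 0 < t) (ht1 : t < 1) {z : ℂ}
    (hz1 : ρ ≤ ‖z‖) (hz2 : ‖z‖ ≤ 1) : DifferentiableAt ℂ (fun z => geom t (phase p n z)) z := by
  have h := differentiableAt_phase d.roots n (d.lt.trans_le hz1)
  exact ((h.pow 2).const_mul _).div ((differentiableAt_const _).sub ((h.pow 2).const_mul _))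
    (d.one_sub_ne_zero ht0 ht1 hz1 hz2)

theorem norm_geom_le (d : PhaseSmall p r ρ n) {t : ℝ} (ht0 : 0 < t) (ht1 : t < 1) {z : ℂ}
    (hz : ‖z‖ = ρ) :
    ‖geom t (phase p n z)‖ ≤ 2 * ((2 / (ρ - r)) ^ p.natDegree * ρ ^ n) ^ 2 := by
  have h1 := d.norm_phase_le hz
  have h2 := d.small
  set κ := (2 / (ρ - r)) ^ p.natDegree * ρ ^ n
  set u := phase p n z
  have h3 : ‖(t : ℂ) ^ 2 * u ^ 2‖ ≤ κ ^ 2 := by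
    rw [norm_mul, norm_pow, norm_pow, Complex.norm_real, Real.norm_of_nonneg ht0.le]
    calc t ^ 2 * ‖u‖ ^ 2 ≤ 1 * κ ^ 2 := by gcongr; nlinarith
      _ = κ ^ 2 := one_mul _
  have h0 : 0 ≤ κ := (norm_nonneg _).trans h1
  have h4 : 1 / 2 ≤ ‖1 - (t : ℂ) ^ 2 * u ^ 2‖ := by
    have := norm_sub_norm_le (1 : ℂ) ((t : ℂ) ^ 2 * u ^ 2)
    rw [norm_one] at this
    nlinarith
  rw [geom, norm_div, div_le_iff₀ (by linarith)]
  nlinarith [sq_nonneg κ]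

theorem norm_eval_le (d : PhaseSmall p r ρ n) {z : ℂ} (hz : ‖z‖ ≤ 1) :
    ‖p.eval z‖ ≤ 2 ^ p.natDegree := by
  refine (Zolotarev.norm_eval_le d.monic d.roots z).trans ?_
  have := d.nonneg
  have := d.lt
  have := d.lt_one
  gcongr
  linarith

theorem norm_recip_eval_le (d : PhaseSmall p r ρ n) {z : ℂ} (hz : ‖z‖ ≤ 1) :
    ‖(recip p).eval z‖ ≤ 2 ^ p.natDegree := by
  refine (Zolotarev.norm_recip_eval_le d.monic d.roots z).trans ?_
  have := d.nonneg
  have := d.lt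
  have := d.lt_one
  have : r * ‖z‖ ≤ 1 := by nlinarith [norm_nonneg z]
  gcongr
  linarith

theorem one_le_const (d : PhaseSmall p r ρ n) : 1 ≤ (2 / (ρ - r)) ^ p.natDegree := by
  have := d.nonneg
  have := d.lt
  have := d.lt_one
  refine one_le_pow₀ ?_
  rw [le_div_iff₀ (by linarith)]
  linarith

theorem one_le_inv_pow (d : PhaseSmall p r ρ n) (k : ℕ) : 1 ≤ (ρ⁻¹) ^ k :=
  one_le_pow₀ ((one_le_inv₀ d.pos).2 d.lt_one.le)

/-- With the weight `|p|²`, the even kernel has nearly the same mass as the constant `2`. -/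
theorem norm_average_weight_mul_geom_le (d : PhaseSmall p r ρ n) {t : ℝ} (ht0 : 0 < t)
    (ht1 : t < 1) :
    ‖circleAverage (fun z => ((‖p.eval z‖ ^ 2 : ℝ) : ℂ) * geom t (phase p n z)) 0 1‖
      ≤ errConst p.natDegree r ρ * ρ ^ n := by
  refine norm_circleAverage_le_of_annulus d.pos d.lt_one.le
    (fun z hz => by rw [normSq_eval_eq p hz]) ?_ ?_
  · intro z hz1 hz2
    exact (((p.differentiable z).mul ((recip p).differentiable z)).mul
      ((differentiableAt_id.pow _).inv (pow_ne_zero _ (d.ne_zero hz1)))).mul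
      (d.differentiableAt_geom ht0 ht1 hz1 hz2)
  · intro z hz
    have h1 := d.norm_eval_le (z := z) (hz.le.trans d.lt_one.le)
    have h2 := d.norm_recip_eval_le (z := z) (hz.le.trans d.lt_one.le)
    have h3 := d.norm_geom_le ht0 ht1 hz
    have h5 := d.small
    have h6 := d.one_le_const
    have h7 := d.one_le_inv_pow p.natDegree
    have h8 : 0 < ρ ^ n := pow_pos d.pos n
    rw [norm_mul, norm_mul, norm_mul, norm_inv, norm_pow, hz, errConst, ← inv_pow,
      two_mul, pow_add, show (4 : ℝ) = 2 * 2 by norm_num, mul_pow]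
    set K := (2 / (ρ - r)) ^ p.natDegree
    set V := (ρ⁻¹) ^ p.natDegree
    set W := (2 : ℝ) ^ p.natDegree
    have hW : 0 < W := by positivity
    calc ‖p.eval z‖ * ‖(recip p).eval z‖ * V * ‖geom t (phase p n z)‖
        ≤ W * W * V * (2 * (K * ρ ^ n) ^ 2) := by gcongr
      _ = 2 * (W * W) * V * 1 * (K * (K * ρ ^ n)) * ρ ^ n := by ring
      _ ≤ 6 * (W * W) * V * V * (K * K) * ρ ^ n := by
          have : K * ρ ^ n ≤ K := by linarith
          gcongr
          norm_num
      _ = 6 * (W * W) * (V * V) * K ^ 2 * ρ ^ n := by ring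

section Test

variable {R : ℂ[X]} {D : ℕ}

/-- Orthogonality of `|p|² u` to the trigonometric polynomials of degree at most `D`, together with
the smallness of the higher odd harmonics. -/
theorem norm_average_odd_le (d : PhaseSmall p r ρ n) (hn : n = p.natDegree + (D + 1))
    (hR : ∀ z, ‖z‖ ≤ 1 → ‖R.eval z‖ ≤ 3) {t : ℝ} (ht0 : 0 < t) (ht1 : t < 1) :
    ‖circleAverage (fun z => ((‖p.eval z‖ ^ 2 : ℝ) : ℂ) * (R.eval z * (z ^ D)⁻¹)
      * (t * phase p n z / (1 - (t : ℂ) ^ 2 * phase p n z ^ 2))) 0 1‖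
      ≤ errConst p.natDegree r ρ * ρ ^ n := by
  have hform : ∀ z, ‖z‖ = 1 → ((‖p.eval z‖ ^ 2 : ℝ) : ℂ) * (R.eval z * (z ^ D)⁻¹)
      * (t * phase p n z / (1 - (t : ℂ) ^ 2 * phase p n z ^ 2))
      = (Polynomial.C (t : ℂ) * (Polynomial.X * (recip p) ^ 2 * R)).eval z
        + t * (z * ((recip p).eval z) ^ 2 * R.eval z) * geom t (phase p n z) := by
    intro z hz
    have h0 : z ≠ 0 := by rintro rfl; simp at hz
    have hp0 : p.eval z ≠ 0 := eval_ne_zero_of_lt d.roots (by rw [hz]; exact d.lt.trans d.lt_one)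
    have h1 := d.one_sub_ne_zero ht0 ht1 (hz ▸ d.lt_one.le) hz.le
    have h2 : ((‖p.eval z‖ ^ 2 : ℝ) : ℂ) * (R.eval z * (z ^ D)⁻¹) * phase p n z
        = z * ((recip p).eval z) ^ 2 * R.eval z := by
      rw [normSq_eval_eq p hz, phase, hn, pow_add, pow_add]
      field_simp
    simp only [Polynomial.eval_mul, Polynomial.eval_C, Polynomial.eval_X, Polynomial.eval_pow]
    rw [← h2, geom]
    field_simp
    ring
  refine norm_circleAverage_le_of_annulus_add d.pos d.lt_one.le _ ?_ hform ?_ ?_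
  · simp [Polynomial.coeff_zero_eq_eval_zero]
  · intro z hz1 hz2
    exact (((differentiableAt_id.mul (((recip p).differentiable z).pow 2)).mul
      (R.differentiable z)).const_mul _).mul (d.differentiableAt_geom ht0 ht1 hz1 hz2)
  · intro z hz
    have h2 := d.norm_recip_eval_le (z := z) (hz.le.trans d.lt_one.le)
    have h3 := d.norm_geom_le ht0 ht1 hz
    have h4 := hR z (hz.le.trans d.lt_one.le)
    have h5 := d.small
    have h6 := d.one_le_const
    have h7 := d.one_le_inv_pow (2 * p.natDegree)
    have h8 : 0 < ρ ^ n := pow_pos d.pos n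
    have h9 := d.lt_one
    have h10 := d.pos
    rw [norm_mul, norm_mul, norm_mul, norm_mul, norm_pow, hz, errConst,
      show (4 : ℝ) = 2 * 2 by norm_num, mul_pow, Complex.norm_real, Real.norm_of_nonneg ht0.le]
    set K := (2 / (ρ - r)) ^ p.natDegree
    set V := (ρ⁻¹) ^ (2 * p.natDegree)
    set W := (2 : ℝ) ^ p.natDegree
    have hW : 0 < W := by positivity
    calc t * (ρ * ‖(recip p).eval z‖ ^ 2 * ‖R.eval z‖) * ‖geom t (phase p n z)‖
        ≤ 1 * (1 * W ^ 2 * 3) * (2 * (K * ρ ^ n) ^ 2) := by gcongr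
      _ = 6 * (W * W) * 1 * (K * (K * ρ ^ n)) * ρ ^ n := by ring
      _ ≤ 6 * (W * W) * V * (K * K) * ρ ^ n := by
          have : K * ρ ^ n ≤ K := by linarith
          gcongr
      _ = 6 * (W * W) * V * K ^ 2 * ρ ^ n := by ring

/-- Apart from the mean value, the analytic half of the even kernel contributes little: the harmonic
`u²` cancels `p²` in the denominator and is exactly orthogonal, the others are small. -/
theorem norm_average_even_le (d : PhaseSmall p r ρ n) (hn : n = p.natDegree + (D + 1))
    (hR : ∀ z, ‖z‖ ≤ 1 → ‖R.eval z‖ ≤ 3) {t : ℝ} (ht0 : 0 < t) (ht1 : t < 1) {s : ℕ}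
    (hs : s ≤ n + p.natDegree) :
    ‖circleAverage (fun z => (p.eval z ^ 2 * (z ^ s)⁻¹ * (R.eval z * (z ^ D)⁻¹))
      * geom t (phase p n z)) 0 1‖ ≤ errConst p.natDegree r ρ * ρ ^ n := by
  obtain ⟨e, he⟩ : ∃ e, n + n = (e + 1) + s + D := ⟨n + n - s - D - 1, by omega⟩
  have hform : ∀ z, ‖z‖ = 1 → (p.eval z ^ 2 * (z ^ s)⁻¹ * (R.eval z * (z ^ D)⁻¹))
      * geom t (phase p n z)
      = (Polynomial.C ((t : ℂ) ^ 2) * (Polynomial.X ^ (e + 1) * (recip p) ^ 2 * R)).eval z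
        + t ^ 2 * (z ^ (e + 1) * ((recip p).eval z) ^ 2 * R.eval z) * geom t (phase p n z) := by
    intro z hz
    have h0 : z ≠ 0 := by rintro rfl; simp at hz
    have hp0 : p.eval z ≠ 0 := eval_ne_zero_of_lt d.roots (by rw [hz]; exact d.lt.trans d.lt_one)
    have h1 := d.one_sub_ne_zero ht0 ht1 (hz ▸ d.lt_one.le) hz.le
    have h2 : (p.eval z ^ 2 * (z ^ s)⁻¹ * (R.eval z * (z ^ D)⁻¹)) * phase p n z ^ 2
        = z ^ (e + 1) * ((recip p).eval z) ^ 2 * R.eval z := by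
      rw [phase, mul_pow, ← pow_mul, mul_two n, he, pow_add, pow_add]
      field_simp
    simp only [Polynomial.eval_mul, Polynomial.eval_C, Polynomial.eval_X, Polynomial.eval_pow]
    rw [← h2, geom]
    field_simp
    ring
  refine norm_circleAverage_le_of_annulus_add d.pos d.lt_one.le _ ?_ hform ?_ ?_
  · simp [Polynomial.coeff_zero_eq_eval_zero]
  · intro z hz1 hz2
    exact ((((differentiableAt_id.pow (e + 1)).mul (((recip p).differentiable z).pow 2)).mul
      (R.differentiable z)).const_mul _).mul (d.differentiableAt_geom ht0 ht1 hz1 hz2)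
  · intro z hz
    have h2 := d.norm_recip_eval_le (z := z) (hz.le.trans d.lt_one.le)
    have h3 := d.norm_geom_le ht0 ht1 hz
    have h4 := hR z (hz.le.trans d.lt_one.le)
    have h5 := d.small
    have h6 := d.one_le_const
    have h7 := d.one_le_inv_pow (2 * p.natDegree)
    have h8 : 0 < ρ ^ n := pow_pos d.pos n
    have h9 : ρ ^ (e + 1) ≤ 1 := pow_le_one₀ d.pos.le d.lt_one.le
    have h10 : t ^ 2 ≤ 1 := pow_le_one₀ ht0.le ht1.le
    have h11 : 0 < ρ ^ (e + 1) := pow_pos d.pos _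
    rw [norm_mul, norm_mul, norm_mul, norm_mul, norm_pow, norm_pow, norm_pow, hz, errConst,
      show (4 : ℝ) = 2 * 2 by norm_num, mul_pow, Complex.norm_real, Real.norm_of_nonneg ht0.le]
    set K := (2 / (ρ - r)) ^ p.natDegree
    set V := (ρ⁻¹) ^ (2 * p.natDegree)
    set W := (2 : ℝ) ^ p.natDegree
    have hW : 0 < W := by positivity
    calc t ^ 2 * (ρ ^ (e + 1) * ‖(recip p).eval z‖ ^ 2 * ‖R.eval z‖) * ‖geom t (phase p n z)‖
        ≤ 1 * (1 * W ^ 2 * 3) * (2 * (K * ρ ^ n) ^ 2) := by gcongr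
      _ = 6 * (W * W) * 1 * (K * (K * ρ ^ n)) * ρ ^ n := by ring
      _ ≤ 6 * (W * W) * V * (K * K) * ρ ^ n := by
          have : K * ρ ^ n ≤ K := by linarith
          gcongr
      _ = 6 * (W * W) * V * K ^ 2 * ρ ^ n := by ring

/-- The antianalytic half of the even kernel; here already `u²` is small on the shifted contour. -/
theorem norm_average_even_conj_le (d : PhaseSmall p r ρ n) (hn : n = p.natDegree + (D + 1))
    (hR : ∀ z, ‖z‖ ≤ 1 → ‖R.eval z‖ ≤ 3) (hreal : ∀ z, ‖z‖ = 1 → (R.eval z * (z ^ D)⁻¹).im = 0)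
    {t : ℝ} (ht0 : 0 < t) (ht1 : t < 1) (s : ℕ) :
    ‖circleAverage (fun z => (p.eval z ^ 2 * (z ^ s)⁻¹ * (R.eval z * (z ^ D)⁻¹))
      * conj (geom t (phase p n z))) 0 1‖ ≤ errConst p.natDegree r ρ * ρ ^ n := by
  rw [← Complex.norm_conj, ← circleAverage_conj]
  refine norm_circleAverage_le_of_annulus (g := fun z => (((recip p).eval z) ^ 2
    * (z ^ (2 * p.natDegree))⁻¹ * z ^ s * (R.eval z * (z ^ D)⁻¹)) * geom t (phase p n z))
    d.pos d.lt_one.le ?_ ?_ ?_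
  · intro z hz
    have h0 : z ≠ 0 := by rintro rfl; simp at hz
    have h1 : conj z = z⁻¹ := by
      rw [Complex.inv_def, Complex.normSq_eq_norm_sq, hz]
      simp
    have h2 : conj (R.eval z * (z ^ D)⁻¹) = R.eval z * (z ^ D)⁻¹ :=
      Complex.conj_eq_iff_im.2 (hreal z hz)
    rw [map_mul, map_mul, h2, map_mul, Complex.conj_conj, map_inv₀, map_pow, map_pow, h1,
      recip_eval_of_norm_eq_one p hz, inv_pow, inv_inv]
    field_simp
    ring
  · intro z hz1 hz2
    have h0 := d.ne_zero hz1
    exact ((((((recip p).differentiable z).pow 2).mul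
      ((differentiableAt_id.pow _).inv (pow_ne_zero _ h0))).mul (differentiableAt_id.pow s)).mul
      ((R.differentiable z).mul ((differentiableAt_id.pow _).inv (pow_ne_zero _ h0)))).mul
      (d.differentiableAt_geom ht0 ht1 hz1 hz2)
  · intro z hz
    have h2 := d.norm_recip_eval_le (z := z) (hz.le.trans d.lt_one.le)
    have h3 := d.norm_geom_le ht0 ht1 hz
    have h4 := hR z (hz.le.trans d.lt_one.le)
    have h6 := d.one_le_const
    have h8 : 0 < ρ ^ n := pow_pos d.pos n
    have h9 : ρ ^ s ≤ 1 := pow_le_one₀ d.pos.le d.lt_one.le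
    have h10 : (ρ ^ D)⁻¹ * ρ ^ n ≤ 1 := by
      rw [hn, show p.natDegree + (D + 1) = D + (p.natDegree + 1) by ring, pow_add,
        inv_mul_cancel_left₀ (pow_ne_zero _ d.pos.ne')]
      exact pow_le_one₀ d.pos.le d.lt_one.le
    have h11 := d.pos
    simp only [norm_mul, norm_pow, norm_inv]
    rw [hz, errConst, show (4 : ℝ) = 2 * 2 by norm_num, mul_pow, ← inv_pow ρ (2 * _)]
    set K := (2 / (ρ - r)) ^ p.natDegree
    set V := (ρ⁻¹) ^ (2 * p.natDegree)
    set W := (2 : ℝ) ^ p.natDegree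
    have hW : 0 < W := by positivity
    calc ‖(recip p).eval z‖ ^ 2 * V * ρ ^ s * (‖R.eval z‖ * (ρ ^ D)⁻¹) * ‖geom t (phase p n z)‖
        ≤ W ^ 2 * V * 1 * (3 * (ρ ^ D)⁻¹) * (2 * (K * ρ ^ n) ^ 2) := by gcongr
      _ = 6 * (W * W) * V * (K * K) * (((ρ ^ D)⁻¹ * ρ ^ n) * ρ ^ n) := by ring
      _ ≤ 6 * (W * W) * V * (K * K) * (1 * ρ ^ n) := by gcongr
      _ = 6 * (W * W) * V * K ^ 2 * ρ ^ n := by ring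

end Test

end PhaseSmall

/-! ### Coefficients of `p² q` -/

namespace PhaseSmall

variable {p : ℂ[X]} {r ρ : ℝ} {n : ℕ} {R : ℂ[X]} {D : ℕ}

theorem continuousAt_phase (d : PhaseSmall p r ρ n) {z : ℂ} (hz : ‖z‖ = 1) :
    ContinuousAt (phase p n) z :=
  (differentiableAt_phase d.roots n (by rw [hz]; exact d.lt.trans d.lt_one)).continuousAt

/-- The average of `|p|² |q|` against the sum of the two Poisson kernels. -/
theorem average_weight_mul_abs_le (d : PhaseSmall p r ρ n) (hn : n = p.natDegree + (D + 1))
    (hreal : ∀ z, ‖z‖ = 1 → (R.eval z * (z ^ D)⁻¹).im = 0) {ε : ℝ} (hε : 0 ≤ ε)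
    (hR : ∀ z, ‖z‖ ≤ 1 → ‖R.eval z‖ ≤ 3)
    (h : ∀ z, ‖z‖ = 1 → |(phase p n z).re + (R.eval z * (z ^ D)⁻¹).re| ≤ 1 + ε)
    {t : ℝ} (ht0 : 0 < t) (ht1 : t < 1) :
    circleAverage (fun z => ‖p.eval z‖ ^ 2 * (|(R.eval z * (z ^ D)⁻¹).re|
      * (poisson t (phase p n z) + poisson t (-phase p n z)))) 0 1
    ≤ 4 * (errConst p.natDegree r ρ * ρ ^ n)
      + 2 * ε * (2 * 4 ^ p.natDegree + 4 * (errConst p.natDegree r ρ * ρ ^ n))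
      + 2 * ((1 - t ^ 2) / t) * 4 ^ p.natDegree := by
  set q : ℂ → ℝ := fun z => (R.eval z * (z ^ D)⁻¹).re with hq
  set W : ℂ → ℝ := fun z => ‖p.eval z‖ ^ 2 with hW
  set P : ℂ → ℝ := fun z => poisson t (phase p n z) with hP
  set Q : ℂ → ℝ := fun z => poisson t (-phase p n z) with hQ
  set B := errConst p.natDegree r ρ * ρ ^ n with hB
  have cW : ∀ z : ℂ, ‖z‖ = 1 → ContinuousAt W z := fun z _ => p.continuous.norm.continuousAt.pow 2
  have cP : ∀ z : ℂ, ‖z‖ = 1 → ContinuousAt P z := fun z hz =>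
    continuousAt_poisson ht0 ht1 (d.continuousAt_phase hz) (d.norm_phase hz)
  have cQ : ∀ z : ℂ, ‖z‖ = 1 → ContinuousAt Q z := fun z hz =>
    continuousAt_poisson ht0 ht1 (d.continuousAt_phase hz).neg
      ((norm_neg _).trans (d.norm_phase hz))
  have cqc : ∀ z : ℂ, ‖z‖ = 1 → ContinuousAt (fun z => R.eval z * (z ^ D)⁻¹) z := fun z hz =>
    R.continuous.continuousAt.mul ((continuousAt_id.pow D).inv₀
      (pow_ne_zero _ (d.ne_zero (hz ▸ d.lt_one.le))))
  have cq : ∀ z : ℂ, ‖z‖ = 1 → ContinuousAt q z := fun z hz =>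
    Complex.continuous_re.continuousAt.comp (cqc z hz)
  have cG : ∀ z : ℂ, ‖z‖ = 1 → ContinuousAt (fun z => geom t (phase p n z)) z := fun z hz =>
    (d.differentiableAt_geom ht0 ht1 (hz ▸ d.lt_one.le) hz.le).continuousAt
  have cH : ∀ z : ℂ, ‖z‖ = 1 → ContinuousAt
      (fun z => t * phase p n z / (1 - (t : ℂ) ^ 2 * phase p n z ^ 2)) z := fun z hz =>
    (continuousAt_const.mul (d.continuousAt_phase hz)).div
      (continuousAt_const.sub (continuousAt_const.mul ((d.continuousAt_phase hz).pow 2)))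
      (d.one_sub_ne_zero ht0 ht1 (hz ▸ d.lt_one.le) hz.le)
  have cWc : ∀ z : ℂ, ‖z‖ = 1 → ContinuousAt (fun z => ((W z : ℝ) : ℂ)) z := fun z hz =>
    Complex.continuous_ofReal.continuousAt.comp (cW z hz)
  have hWle : circleAverage W 0 1 ≤ 4 ^ p.natDegree := by
    refine circleAverage_mono_on_of_le_circle (circleIntegrable_of_continuousAt cW) fun z hz => ?_
    have hz1 : ‖z‖ = 1 := by simpa using hz
    have := d.norm_eval_le hz1.le
    calc ‖p.eval z‖ ^ 2 ≤ (2 ^ p.natDegree) ^ 2 := by gcongr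
      _ = 4 ^ p.natDegree := by rw [← pow_mul, mul_comm, pow_mul]; norm_num
  have i1 : CircleIntegrable (fun z => W z * (q z * (P z - Q z))) 0 1 :=
    circleIntegrable_of_continuousAt fun z hz =>
      (cW z hz).mul ((cq z hz).mul ((cP z hz).sub (cQ z hz)))
  have i2 : CircleIntegrable (fun z => W z * (P z + Q z)) 0 1 :=
    circleIntegrable_of_continuousAt fun z hz => (cW z hz).mul ((cP z hz).add (cQ z hz))
  have i3 : CircleIntegrable W 0 1 := circleIntegrable_of_continuousAt cW
  have hpt : ∀ z, ‖z‖ = 1 → W z * (|q z| * (P z + Q z)) ≤ (-1) * (W z * (q z * (P z - Q z)))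
      + 2 * ε * (W z * (P z + Q z)) + 2 * ((1 - t ^ 2) / t) * W z := by
    intro z hz
    have h1 := abs_mul_poisson_le ht0 ht1 (d.norm_phase hz) hε (h z hz)
    have h2 := mul_le_mul_of_nonneg_left h1 (sq_nonneg ‖p.eval z‖)
    calc _ ≤ _ := h2
      _ = _ := by simp only [hW, hP, hQ, hq]; ring
  -- `P - Q` contains only odd powers of `u`
  have a1 : |circleAverage (fun z => W z * (q z * (P z - Q z))) 0 1| ≤ 4 * B := by
    have e1 : ∀ z, ‖z‖ = 1 → W z * (q z * (P z - Q z))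
        = (4 : ℝ) • (((‖p.eval z‖ ^ 2 : ℝ) : ℂ) * (R.eval z * (z ^ D)⁻¹)
          * (t * phase p n z / (1 - (t : ℂ) ^ 2 * phase p n z ^ 2))).re := by
      intro z hz
      have hqz : R.eval z * (z ^ D)⁻¹ = (q z : ℂ) := eq_ofReal_re (hreal z hz)
      rw [hP, hQ]
      simp only
      rw [poisson_sub_poisson_neg ht0 ht1 (d.norm_phase hz), hqz, ← Complex.ofReal_mul,
        Complex.re_ofReal_mul, smul_eq_mul]
      ring
    have i4 : CircleIntegrable (fun z => ((‖p.eval z‖ ^ 2 : ℝ) : ℂ) * (R.eval z * (z ^ D)⁻¹)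
          * (t * phase p n z / (1 - (t : ℂ) ^ 2 * phase p n z ^ 2))) 0 1 :=
      circleIntegrable_of_continuousAt fun z hz => ((cWc z hz).mul (cqc z hz)).mul (cH z hz)
    rw [circleAverage_congr e1, circleAverage_fun_smul, circleAverage_re i4, smul_eq_mul,
      abs_mul, abs_of_pos (by norm_num : (0 : ℝ) < 4)]
    gcongr
    exact (Complex.abs_re_le_norm _).trans (d.norm_average_odd_le hn hR ht0 ht1)
  -- `P + Q` is the constant `2` up to the harmonics `u ^ (2 j)`, `j ≠ 0`
  have a2 : circleAverage (fun z => W z * (P z + Q z)) 0 1 ≤ 2 * 4 ^ p.natDegree + 4 * B := by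
    have e1 : ∀ z, ‖z‖ = 1 → W z * (P z + Q z) = (2 : ℝ) • W z
        + (4 : ℝ) • (((‖p.eval z‖ ^ 2 : ℝ) : ℂ) * geom t (phase p n z)).re := by
      intro z hz
      rw [hP, hQ]
      simp only
      rw [poisson_add_poisson_neg ht0 ht1 (d.norm_phase hz), Complex.re_ofReal_mul, smul_eq_mul,
        smul_eq_mul, geom]
      ring
    have i4 : CircleIntegrable (fun z => ((‖p.eval z‖ ^ 2 : ℝ) : ℂ) * geom t (phase p n z)) 0 1 :=
      circleIntegrable_of_continuousAt fun z hz => (cWc z hz).mul (cG z hz)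
    have i5 : CircleIntegrable (fun z => (2 : ℝ) • W z) 0 1 := i3.const_fun_smul
    have i6 : CircleIntegrable
        (fun z => (4 : ℝ) • (((‖p.eval z‖ ^ 2 : ℝ) : ℂ) * geom t (phase p n z)).re) 0 1 :=
      circleIntegrable_of_continuousAt fun z hz => continuousAt_const.mul
        (Complex.continuous_re.continuousAt.comp ((cWc z hz).mul (cG z hz)))
    rw [circleAverage_congr e1, circleAverage_fun_add i5 i6, circleAverage_fun_smul,
      circleAverage_fun_smul, circleAverage_re i4, smul_eq_mul, smul_eq_mul]
    have := (Complex.re_le_norm _).trans (d.norm_average_weight_mul_geom_le ht0 ht1)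
    gcongr
  have hκ : 0 ≤ (1 - t ^ 2) / t := div_nonneg (by nlinarith) ht0.le
  calc _ ≤ circleAverage (fun z => (-1 : ℝ) • (W z * (q z * (P z - Q z)))
      + (2 * ε) • (W z * (P z + Q z)) + (2 * ((1 - t ^ 2) / t)) • W z) 0 1 := by
        refine circleAverage_mono (circleIntegrable_of_continuousAt fun z hz =>
          (cW z hz).mul ((cq z hz).abs.mul ((cP z hz).add (cQ z hz)))) ?_ ?_
        · exact ((i1.const_smul).add (i2.const_smul)).add (i3.const_smul)
        · intro z hz
          simp only [smul_eq_mul]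
          exact hpt z (by simpa using hz)
    _ = (-1) * circleAverage (fun z => W z * (q z * (P z - Q z))) 0 1
        + (2 * ε) * circleAverage (fun z => W z * (P z + Q z)) 0 1
        + (2 * ((1 - t ^ 2) / t)) * circleAverage W 0 1 := by
        rw [circleAverage_linear_combination (-1) (2 * ε) (2 * ((1 - t ^ 2) / t)) i1 i2 i3]
        simp only [smul_eq_mul]
    _ ≤ _ := by
        have := (abs_le.1 a1).1
        have : (-1) * circleAverage (fun z => W z * (q z * (P z - Q z))) 0 1 ≤ 4 * B := by linarith
        gcongr

/-- The coefficients of `p² q` at the nonnegative exponents, for a real trigonometric polynomial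
`q` of degree at most `D = n - l - 1` such that `Re u + q` stays in `[-1 - ε, 1 + ε]`. -/
theorem norm_coeff_sq_mul_le (d : PhaseSmall p r ρ n) (hn : n = p.natDegree + (D + 1))
    (hreal : ∀ z, ‖z‖ = 1 → (R.eval z * (z ^ D)⁻¹).im = 0) {ε : ℝ} (hε : 0 ≤ ε) (hε1 : ε ≤ 1)
    (h : ∀ z, ‖z‖ = 1 → |(phase p n z).re + (R.eval z * (z ^ D)⁻¹).re| ≤ 1 + ε)
    {s : ℕ} (hs : s ≤ n + p.natDegree) :
    ‖(p ^ 2 * R).coeff (s + D)‖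
      ≤ (4 * errConst p.natDegree r ρ + 2 * 4 ^ p.natDegree) * (ε + ρ ^ n) := by
  have hR : ∀ z, ‖z‖ ≤ 1 → ‖R.eval z‖ ≤ 3 := fun z hz => by
    refine norm_eval_le_of_norm_le_one (fun z hz => ?_) hz
    have h1 : R.eval z * (z ^ D)⁻¹ = ((R.eval z * (z ^ D)⁻¹).re : ℂ) := eq_ofReal_re (hreal z hz)
    have h2 : ‖R.eval z * (z ^ D)⁻¹‖ = ‖R.eval z‖ := by simp [hz]
    rw [← h2, h1, Complex.norm_real, Real.norm_eq_abs]
    have h3 := abs_re_le_one (d.norm_phase hz)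
    have h4 := abs_le.1 (h z hz)
    rw [abs_le]
    constructor <;> linarith
  have hρn : ρ ^ n ≤ 1 := pow_le_one₀ d.pos.le d.lt_one.le
  have hρn0 : 0 < ρ ^ n := pow_pos d.pos n
  -- `t` is so close to `1` that `(1 - t²) / t ≤ ρ ^ n`
  obtain ⟨t, ht0, ht1, ht⟩ : ∃ t : ℝ, 0 < t ∧ t < 1 ∧ (1 - t ^ 2) / t ≤ ρ ^ n := by
    refine ⟨1 - ρ ^ n / 4, by linarith, by linarith, ?_⟩
    rw [div_le_iff₀ (by linarith)]
    nlinarith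
  set f : ℂ → ℂ := fun z => p.eval z ^ 2 * (z ^ s)⁻¹ * (R.eval z * (z ^ D)⁻¹) with hf
  set G : ℂ → ℂ := fun z => geom t (phase p n z) with hG
  have cf : ∀ z : ℂ, ‖z‖ = 1 → ContinuousAt f z := fun z hz => by
    have h0 : z ≠ 0 := d.ne_zero (hz ▸ d.lt_one.le)
    exact ((p.continuous.continuousAt.pow 2).mul ((continuousAt_id.pow s).inv₀
      (pow_ne_zero _ h0))).mul (R.continuous.continuousAt.mul ((continuousAt_id.pow D).inv₀
      (pow_ne_zero _ h0)))
  have cG : ∀ z : ℂ, ‖z‖ = 1 → ContinuousAt G z := fun z hz =>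
    (d.differentiableAt_geom ht0 ht1 (hz ▸ d.lt_one.le) hz.le).continuousAt
  have i0 : CircleIntegrable f 0 1 := circleIntegrable_of_continuousAt cf
  have i1 : CircleIntegrable (fun z => f z * G z) 0 1 :=
    circleIntegrable_of_continuousAt fun z hz => (cf z hz).mul (cG z hz)
  have i2 : CircleIntegrable (fun z => f z * conj (G z)) 0 1 :=
    circleIntegrable_of_continuousAt fun z hz =>
      (cf z hz).mul (Complex.continuous_conj.continuousAt.comp (cG z hz))
  have hcoeff : circleAverage f 0 1 = (p ^ 2 * R).coeff (s + D) := by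
    rw [← circleAverage_eval_mul_inv_pow]
    refine circleAverage_congr fun z hz => ?_
    simp only [hf, Polynomial.eval_mul, Polynomial.eval_pow, pow_add, mul_inv]
    ring
  have hsum : ∀ z, ‖z‖ = 1 →
      f z * ((poisson t (phase p n z) + poisson t (-phase p n z) : ℝ) : ℂ)
      = (2 : ℝ) • f z + (2 : ℝ) • (f z * G z) + (2 : ℝ) • (f z * conj (G z)) := by
    intro z hz
    rw [poisson_add_poisson_neg ht0 ht1 (d.norm_phase hz)]
    have h1 : ((G z).re : ℂ) = (G z + conj (G z)) / 2 := Complex.re_eq_add_conj _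
    change f z * ((2 + 4 * (G z).re : ℝ) : ℂ) = _
    push_cast
    rw [h1]
    simp only [Complex.real_smul]
    push_cast
    ring
  have havg : circleAverage
      (fun z => f z * ((poisson t (phase p n z) + poisson t (-phase p n z) : ℝ) : ℂ)) 0 1
      = 2 * (p ^ 2 * R).coeff (s + D) + (2 * circleAverage (fun z => f z * G z) 0 1
        + 2 * circleAverage (fun z => f z * conj (G z)) 0 1) := by
    rw [circleAverage_congr hsum, circleAverage_linear_combination 2 2 2 i0 i1 i2, hcoeff]
    simp only [Complex.real_smul]
    push_cast
    ring
  have hnorm : ‖circleAverage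
      (fun z => f z * ((poisson t (phase p n z) + poisson t (-phase p n z) : ℝ) : ℂ)) 0 1‖
      ≤ circleAverage (fun z => ‖p.eval z‖ ^ 2 * (|(R.eval z * (z ^ D)⁻¹).re|
      * (poisson t (phase p n z) + poisson t (-phase p n z)))) 0 1 := by
    refine (norm_circleAverage_le_circleAverage_norm _).trans (le_of_eq ?_)
    refine circleAverage_congr fun z hz => ?_
    have h1 : R.eval z * (z ^ D)⁻¹ = ((R.eval z * (z ^ D)⁻¹).re : ℂ) := eq_ofReal_re (hreal z hz)
    have h2 : ‖R.eval z * (z ^ D)⁻¹‖ = |(R.eval z * (z ^ D)⁻¹).re| := by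
      conv_lhs => rw [h1]
      rw [Complex.norm_real, Real.norm_eq_abs]
    have h3 := poisson_nonneg (u := phase p n z) ht0 ht1
    have h4 := poisson_nonneg (u := -phase p n z) ht0 ht1
    simp only [hf]
    rw [norm_mul, norm_mul, h2, Complex.norm_real, Real.norm_of_nonneg (add_nonneg h3 h4),
      norm_mul, norm_pow, norm_inv, norm_pow, hz, one_pow, inv_one, mul_one, mul_assoc]
  have b1 := d.average_weight_mul_abs_le hn hreal hε hR h ht0 ht1
  have b2 := d.norm_average_even_le hn hR ht0 ht1 hs
  have b3 := d.norm_average_even_conj_le hn hR hreal ht0 ht1 s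
  have b4 := hnorm.trans b1
  rw [havg] at b4
  set E := (p ^ 2 * R).coeff (s + D)
  set X := circleAverage (fun z => f z * G z) 0 1
  set Y := circleAverage (fun z => f z * conj (G z)) 0 1
  have b5 : 2 * ‖E‖ ≤ ‖2 * E + (2 * X + 2 * Y)‖ + (2 * ‖X‖ + 2 * ‖Y‖) := by
    have e1 : (2 : ℂ) * E = (2 * E + (2 * X + 2 * Y)) - (2 * X + 2 * Y) := by ring
    have e2 : ‖(2 : ℂ) * E‖ = 2 * ‖E‖ := by rw [norm_mul]; norm_num
    have e3 : ‖(2 : ℂ) * X + 2 * Y‖ ≤ 2 * ‖X‖ + 2 * ‖Y‖ := by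
      refine (norm_add_le _ _).trans ?_
      rw [norm_mul, norm_mul]
      norm_num
    rw [← e2]
    conv_lhs => rw [e1]
    exact (norm_sub_le _ _).trans (by gcongr)
  have hB0 : 0 ≤ errConst p.natDegree r ρ := by
    have := d.pos
    unfold errConst
    positivity
  have hF : (0 : ℝ) < 4 ^ p.natDegree := by positivity
  change ‖X‖ ≤ _ at b2
  change ‖Y‖ ≤ _ at b3
  have b6 : ε * (errConst p.natDegree r ρ * ρ ^ n) ≤ ε * errConst p.natDegree r ρ := by
    gcongr
    nlinarith
  have b7 : (1 - t ^ 2) / t * 4 ^ p.natDegree ≤ ρ ^ n * 4 ^ p.natDegree := by gcongr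
  have b8 : 0 ≤ ρ ^ n * 4 ^ p.natDegree := by positivity
  nlinarith

end PhaseSmall

/-! ### From the coefficients to the stability of the extremal function -/

section Division

variable {r δ : ℝ} {j₀ : ℕ}

theorem norm_coeff_le_of_X_sub_C_mul {F : ℂ[X]} {a : ℂ} (ha : ‖a‖ ≤ r) (hr : r < 1)
    (h : ∀ i ≥ j₀, ‖((Polynomial.X - Polynomial.C a) * F).coeff i‖ ≤ δ) :
    ∀ i ≥ j₀, ‖F.coeff i‖ ≤ δ / (1 - r) := by
  have hr1 : 0 < 1 - r := by linarith
  have hδ : 0 ≤ δ := (norm_nonneg _).trans (h j₀ le_rfl)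
  have key : ∀ k i, j₀ ≤ i → F.natDegree < i + k → ‖F.coeff i‖ ≤ δ / (1 - r) := by
    intro k
    induction k with
    | zero =>
      intro i _ hi
      rw [Polynomial.coeff_eq_zero_of_natDegree_lt (by omega), norm_zero]
      positivity
    | succ k ih =>
      intro i hi hk
      have h1 := ih (i + 1) (by omega) (by omega)
      have h2 := h (i + 1) (by omega)
      have h3 : F.coeff i = ((Polynomial.X - Polynomial.C a) * F).coeff (i + 1)
          + a * F.coeff (i + 1) := by
        rw [sub_mul, Polynomial.coeff_sub, Polynomial.coeff_X_mul, Polynomial.coeff_C_mul]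
        ring
      have h0 : 0 ≤ r := (norm_nonneg a).trans ha
      calc ‖F.coeff i‖ ≤ δ + r * (δ / (1 - r)) := by
            rw [h3]
            refine (norm_add_le _ _).trans ?_
            rw [norm_mul]
            gcongr
        _ = δ / (1 - r) := by field_simp; ring
  exact fun i hi => key (F.natDegree + 1) i hi (by omega)

theorem norm_coeff_le_of_multiset_prod_mul {s : Multiset ℂ} (hs : ∀ a ∈ s, ‖a‖ ≤ r) (hr : r < 1)
    {F : ℂ[X]}
    (h : ∀ i ≥ j₀, ‖((s.map fun a => Polynomial.X - Polynomial.C a).prod * F).coeff i‖ ≤ δ) :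
    ∀ i ≥ j₀, ‖F.coeff i‖ ≤ δ / (1 - r) ^ s.card := by
  induction s using Multiset.induction generalizing δ with
  | empty => simpa using h
  | cons a s ih =>
    rw [Multiset.card_cons, pow_succ', ← div_div]
    refine ih (fun b hb => hs b (by simp [hb])) ?_
    refine norm_coeff_le_of_X_sub_C_mul (hs a (by simp)) hr ?_
    simpa [mul_assoc] using h

/-- Division by a monic polynomial with all roots in the disc `|z| ≤ r < 1` is stable for the
leading coefficients. -/
theorem norm_coeff_le_of_mul {p F : ℂ[X]} (hp : p.Monic) (hroots : ∀ z, p.IsRoot z → ‖z‖ ≤ r)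
    (hr : r < 1) (h : ∀ i ≥ j₀, ‖(p * F).coeff i‖ ≤ δ) :
    ∀ i ≥ j₀, ‖F.coeff i‖ ≤ δ / (1 - r) ^ p.natDegree := by
  rw [← card_roots_eq_natDegree]
  refine norm_coeff_le_of_multiset_prod_mul (fun a ha => norm_le_of_mem_roots hroots ha) hr ?_
  rwa [← (IsAlgClosed.splits p).eq_prod_roots_of_monic hp]

end Division

section RealTrig

variable {R : ℂ[X]} {D : ℕ}

/-- The symmetry of the coefficients of a real trigonometric polynomial. -/
theorem coeff_sub_eq_conj (hreal : ∀ z, ‖z‖ = 1 → (R.eval z * (z ^ D)⁻¹).im = 0) {j : ℕ}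
    (hj : j ≤ D) : R.coeff (D - j) = conj (R.coeff (D + j)) := by
  rw [← circleAverage_eval_mul_inv_pow, ← circleAverage_eval_mul_inv_pow, ← circleAverage_conj]
  refine circleAverage_congr fun z hz => ?_
  have h0 : z ≠ 0 := by rintro rfl; simp at hz
  have h1 : conj z = z⁻¹ := by
    rw [Complex.inv_def, Complex.normSq_eq_norm_sq, hz]
    simp
  have h2 : conj (R.eval z * (z ^ D)⁻¹) = R.eval z * (z ^ D)⁻¹ :=
    Complex.conj_eq_iff_im.2 (hreal z hz)
  have h3 : R.eval z * (z ^ (D + j))⁻¹ = R.eval z * (z ^ D)⁻¹ * (z ^ j)⁻¹ := by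
    rw [pow_add, mul_inv]; ring
  rw [h3, map_mul, h2, map_inv₀, map_pow, h1, inv_pow, inv_inv, mul_assoc]
  congr 1
  obtain ⟨i, rfl⟩ := Nat.exists_eq_add_of_le hj
  rw [Nat.add_sub_cancel_left, pow_add]
  field_simp

theorem norm_eval_le_of_norm_coeff_le
    (hreal : ∀ z, ‖z‖ = 1 → (R.eval z * (z ^ D)⁻¹).im = 0) (hdeg : R.natDegree ≤ 2 * D) {δ : ℝ}
    (h : ∀ i ≥ D, ‖R.coeff i‖ ≤ δ) {z : ℂ} (hz : ‖z‖ = 1) :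
    ‖R.eval z‖ ≤ (2 * D + 1) * δ := by
  rw [Polynomial.eval_eq_sum_range' (n := 2 * D + 1) (by omega)]
  have h1 : ∀ i ∈ Finset.range (2 * D + 1), ‖R.coeff i * z ^ i‖ ≤ δ := by
    intro i _
    rw [norm_mul, norm_pow, hz, one_pow, mul_one]
    rcases le_or_gt D i with hi | hi
    · exact h i hi
    · have := coeff_sub_eq_conj hreal (j := D - i) (by omega)
      rw [show D - (D - i) = i by omega] at this
      rw [this, Complex.norm_conj]
      exact h _ (by omega)
  refine (norm_sum_le_of_le _ h1).trans (le_of_eq ?_)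
  simp

/-- A real trigonometric polynomial of degree at most `D` is `R(z) / z ^ D` on the unit circle. -/
theorem exists_polynomial_eq_re (e : ℕ → ℂ) (D : ℕ) :
    ∃ R : ℂ[X], R.natDegree ≤ 2 * D ∧ ∀ z, ‖z‖ = 1 →
      R.eval z * (z ^ D)⁻¹ = ((∑ i ∈ Finset.range (D + 1), e i * z ^ i).re : ℂ) := by
  refine ⟨∑ i ∈ Finset.range (D + 1), (Polynomial.C (e i / 2) * Polynomial.X ^ (D + i)
    + Polynomial.C (conj (e i) / 2) * Polynomial.X ^ (D - i)), ?_, ?_⟩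
  · refine Polynomial.natDegree_sum_le_of_forall_le _ _ fun i hi => ?_
    have hi' : i < D + 1 := Finset.mem_range.1 hi
    refine (Polynomial.natDegree_add_le _ _).trans (max_le ?_ ?_)
    · exact (Polynomial.natDegree_C_mul_X_pow_le _ _).trans (by omega)
    · exact (Polynomial.natDegree_C_mul_X_pow_le _ _).trans (by omega)
  · intro z hz
    have h0 : z ≠ 0 := by rintro rfl; simp at hz
    have h1 : conj z = z⁻¹ := by
      rw [Complex.inv_def, Complex.normSq_eq_norm_sq, hz]
      simp
    rw [Complex.re_sum, Complex.ofReal_sum, Polynomial.eval_finsetSum, Finset.sum_mul]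
    refine Finset.sum_congr rfl fun i hi => ?_
    have hi' : i < D + 1 := Finset.mem_range.1 hi
    rw [Complex.re_eq_add_conj, map_mul, map_pow, h1]
    simp only [Polynomial.eval_add, Polynomial.eval_mul, Polynomial.eval_C, Polynomial.eval_pow,
      Polynomial.eval_X]
    obtain ⟨j, rfl⟩ : ∃ j, D = i + j := ⟨D - i, by omega⟩
    rw [Nat.add_sub_cancel_left, pow_add, pow_add, inv_pow]
    field_simp

end RealTrig

/-- The constant in the stability estimate `PhaseSmall.abs_re_sum_le`. -/
noncomputable def stabConst (l : ℕ) (r ρ : ℝ) : ℝ :=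
  (4 * errConst l r ρ + 2 * 4 ^ l) / (1 - r) ^ l / (1 - r) ^ l

/-- Stability of the extremal property of `Re u`: a trigonometric polynomial `q` of degree less
than `n - l` for which `|Re u + q| ≤ 1 + ε` is small. -/
theorem PhaseSmall.abs_re_sum_le {p : ℂ[X]} {r ρ : ℝ} {n D : ℕ} (d : PhaseSmall p r ρ n)
    (hn : n = p.natDegree + (D + 1)) (e : ℕ → ℂ) {ε : ℝ} (hε : 0 ≤ ε) (hε1 : ε ≤ 1)
    (h : ∀ z, ‖z‖ = 1 →
      |(phase p n z).re + (∑ i ∈ Finset.range (D + 1), e i * z ^ i).re| ≤ 1 + ε)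
    {z : ℂ} (hz : ‖z‖ = 1) :
    |(∑ i ∈ Finset.range (D + 1), e i * z ^ i).re|
      ≤ (2 * n) * (stabConst p.natDegree r ρ * (ε + ρ ^ n)) := by
  obtain ⟨R, hdeg, hR⟩ := exists_polynomial_eq_re e D
  have hreal : ∀ z, ‖z‖ = 1 → (R.eval z * (z ^ D)⁻¹).im = 0 := fun z hz => by
    rw [hR z hz, Complex.ofReal_im]
  have h' : ∀ z, ‖z‖ = 1 → |(phase p n z).re + (R.eval z * (z ^ D)⁻¹).re| ≤ 1 + ε :=
    fun z hz => by
      rw [hR z hz, Complex.ofReal_re]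
      exact h z hz
  have hr1 : r < 1 := d.lt.trans d.lt_one
  have hB0 : 0 ≤ errConst p.natDegree r ρ := by
    have := d.pos
    unfold errConst
    positivity
  have hρ := d.pos
  have h1 : ∀ i ≥ D, ‖(p * (p * R)).coeff i‖
      ≤ (4 * errConst p.natDegree r ρ + 2 * 4 ^ p.natDegree) * (ε + ρ ^ n) := by
    intro i hi
    rw [← mul_assoc, ← pow_two]
    rcases le_or_gt i (n + p.natDegree + D) with h | h
    · obtain ⟨s, rfl⟩ := Nat.exists_eq_add_of_le' hi
      exact d.norm_coeff_sq_mul_le hn hreal hε hε1 h' (by omega)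
    · rw [Polynomial.coeff_eq_zero_of_natDegree_lt, norm_zero]
      · positivity
      · refine (Polynomial.natDegree_mul_le.trans
          (Nat.add_le_add Polynomial.natDegree_pow_le hdeg)).trans_lt ?_
        omega
  have h2 := norm_coeff_le_of_mul d.monic d.roots hr1
    (norm_coeff_le_of_mul d.monic d.roots hr1 h1)
  have h3 := norm_eval_le_of_norm_coeff_le hreal hdeg h2 hz
  have h4 : ‖R.eval z * (z ^ D)⁻¹‖ = ‖R.eval z‖ := by simp [hz]
  rw [hR z hz, Complex.norm_real, Real.norm_eq_abs] at h4
  rw [h4]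
  refine h3.trans ?_
  have h5 : (2 * (D : ℝ) + 1) ≤ 2 * n := by
    rw [hn]
    push_cast
    have : (0 : ℝ) ≤ p.natDegree := by positivity
    linarith
  have h6 : 0 < 1 - r := by linarith
  have h7 : (4 * errConst p.natDegree r ρ + 2 * 4 ^ p.natDegree) * (ε + ρ ^ n)
      / (1 - r) ^ p.natDegree / (1 - r) ^ p.natDegree
      = stabConst p.natDegree r ρ * (ε + ρ ^ n) := by
    rw [stabConst]
    ring
  rw [h7]
  have h8 : 0 ≤ stabConst p.natDegree r ρ * (ε + ρ ^ n) := by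
    rw [stabConst]
    positivity
  gcongr

/-- The extremal values `±1` of `Re u` are attained on the unit circle, since `|p|² u` has mean
value zero. -/
theorem exists_abs_re_phase_eq_one {p : ℂ[X]} {r : ℝ} (hr : ∀ z, p.IsRoot z → ‖z‖ ≤ r)
    (hr1 : r < 1) {n : ℕ} (hn : p.natDegree < n) :
    ∃ z : ℂ, ‖z‖ = 1 ∧ |(phase p n z).re| = 1 := by
  obtain ⟨D, rfl⟩ : ∃ D, n = p.natDegree + (D + 1) := ⟨n - p.natDegree - 1, by omega⟩
  set n := p.natDegree + (D + 1) with hn'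
  set g : ℝ → ℝ := fun θ => ‖p.eval (circleMap 0 1 θ)‖ ^ 2
    * (phase p n (circleMap 0 1 θ)).im with hg
  have hcirc : ∀ θ, ‖circleMap 0 1 θ‖ = 1 := fun θ => by simp
  have hcont : Continuous g := by
    refine Continuous.mul (((p.continuous.comp (continuous_circleMap 0 1)).norm).pow 2) ?_
    refine Complex.continuous_im.comp (continuous_iff_continuousAt.2 fun θ => ?_)
    exact ContinuousAt.comp (g := phase p n)
      (differentiableAt_phase hr n (by rw [hcirc]; exact hr1)).continuousAt
      (continuous_circleMap 0 1).continuousAt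
  have hint : ∫ θ in (0 : ℝ)..2 * π, g θ = 0 := by
    have h1 : circleAverage (fun z => ((‖p.eval z‖ ^ 2 : ℝ) : ℂ) * phase p n z) 0 1 = 0 := by
      have h2 : ∀ z : ℂ, ‖z‖ = 1 → ((‖p.eval z‖ ^ 2 : ℝ) : ℂ) * phase p n z
          = (Polynomial.X ^ (D + 1) * recip p ^ 2).eval z * (z ^ 0)⁻¹ := by
        intro z hz
        have h0 : z ≠ 0 := by rintro rfl; simp at hz
        have hp0 : p.eval z ≠ 0 := eval_ne_zero_of_lt hr (by rw [hz]; exact hr1)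
        simp only [normSq_eval_eq p hz, phase, hn', pow_add, Polynomial.eval_mul,
          Polynomial.eval_pow, Polynomial.eval_X]
        field_simp
      rw [circleAverage_congr h2, circleAverage_eval_mul_inv_pow,
        Polynomial.coeff_zero_eq_eval_zero]
      simp
    have hci : CircleIntegrable (fun z => ((‖p.eval z‖ ^ 2 : ℝ) : ℂ) * phase p n z) 0 1 :=
      circleIntegrable_of_continuousAt fun z hz =>
        (Complex.continuous_ofReal.comp (p.continuous.norm.pow 2)).continuousAt.mul
          (differentiableAt_phase hr n (by rw [hz]; exact hr1)).continuousAt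
    have h3 : circleAverage (fun z => (((‖p.eval z‖ ^ 2 : ℝ) : ℂ) * phase p n z).im) 0 1 = 0 := by
      have h4 : circleAverage (fun z => (((‖p.eval z‖ ^ 2 : ℝ) : ℂ) * phase p n z).im) 0 1
          = (circleAverage (fun z => ((‖p.eval z‖ ^ 2 : ℝ) : ℂ) * phase p n z) 0 1).im :=
        Complex.imCLM.circleAverage_comp_comm hci
      rw [h4, h1, Complex.zero_im]
    rw [circleAverage_def, smul_eq_zero_iff_right (inv_ne_zero (by positivity : 2 * π ≠ 0))] at h3
    have h5 : g = fun θ => (((‖p.eval (circleMap 0 1 θ)‖ ^ 2 : ℝ) : ℂ)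
        * phase p n (circleMap 0 1 θ)).im := by
      funext θ
      simp only [hg, Complex.im_ofReal_mul]
    rw [h5]
    exact h3
  have hzero : ∃ θ, g θ = 0 := by
    have hpi : (0 : ℝ) < 2 * π := by positivity
    have hpos : ∃ θ, g θ ≤ 0 := by
      by_contra! hc
      exact (intervalIntegral.intervalIntegral_pos_of_pos (hcont.intervalIntegrable _ _) hc hpi).ne'
        hint
    have hneg : ∃ θ, 0 ≤ g θ := by
      by_contra! hc
      have := intervalIntegral.intervalIntegral_pos_of_pos (f := fun θ => -g θ)
        (hcont.neg.intervalIntegrable _ _) (fun θ => neg_pos.2 (hc θ)) hpi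
      rw [intervalIntegral.integral_neg, hint] at this
      simp at this
    exact mem_range_of_exists_le_of_exists_ge hcont hpos hneg
  obtain ⟨θ, hθ⟩ := hzero
  have h1 : p.eval (circleMap 0 1 θ) ≠ 0 := eval_ne_zero_of_lt hr (by rw [hcirc]; exact hr1)
  have h2 : (phase p n (circleMap 0 1 θ)).im = 0 := by
    rcases mul_eq_zero.1 hθ with h | h
    · exact absurd (norm_eq_zero.1 (pow_eq_zero_iff two_ne_zero |>.1 h)) h1
    · exact h
  refine ⟨circleMap 0 1 θ, hcirc θ, ?_⟩
  have h3 := norm_phase_of_norm_eq_one hr hr1 n (hcirc θ)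
  rwa [eq_ofReal_re h2, Complex.norm_real, Real.norm_eq_abs] at h3

/-! ### Taylor coefficients of `p / p^*` -/

section Taylor

variable {p : ℂ[X]} {r ρ : ℝ}

/-- The Taylor expansion of `p / p^*`, with Cauchy's estimate on the circle `|z| = 1 / ρ`. -/
theorem exists_taylor (hp : p.Monic) (hr : ∀ z, p.IsRoot z → ‖z‖ ≤ r) (hr0 : 0 ≤ r) (hrρ : r < ρ)
    (hρ : ρ < 1) : ∃ σ : ℕ → ℂ, (∀ j, ‖σ j‖ ≤ (2 / (ρ - r)) ^ p.natDegree * ρ ^ j) ∧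
      ∀ z : ℂ, ‖z‖ ≤ 1 → HasSum (fun j => σ j * z ^ j) (p.eval z / (recip p).eval z) := by
  have hρ0 : 0 < ρ := hr0.trans_lt hrρ
  set f : ℂ → ℂ := fun z => p.eval z / (recip p).eval z with hf
  have hne : ∀ z : ℂ, ‖z‖ ≤ ρ⁻¹ → (recip p).eval z ≠ 0 := fun z hz => by
    refine recip_eval_ne_zero hp hr ?_
    calc r * ‖z‖ ≤ r * ρ⁻¹ := by gcongr
      _ < 1 := by rw [← div_eq_mul_inv, div_lt_one hρ0]; exact hrρ
  have hdiff : ∀ z : ℂ, ‖z‖ ≤ ρ⁻¹ → DifferentiableAt ℂ f z := fun z hz =>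
    (p.differentiable z).div ((recip p).differentiable z) (hne z hz)
  have hcl : DiffContOnCl ℂ f (Metric.ball 0 ρ⁻¹) := by
    refine DifferentiableOn.diffContOnCl fun z hz => ?_
    rw [closure_ball _ (inv_ne_zero hρ0.ne')] at hz
    exact (hdiff z (by simpa using hz)).differentiableWithinAt
  have hbound : ∀ z ∈ Metric.sphere (0 : ℂ) ρ⁻¹, ‖f z‖ ≤ (2 / (ρ - r)) ^ p.natDegree := by
    intro z hz
    have hz' : ‖z‖ = ρ⁻¹ := by simpa using hz
    have hrρ1 : r * ρ⁻¹ < 1 := by rw [← div_eq_mul_inv, div_lt_one hρ0]; exact hrρ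
    have h1 := norm_eval_le hp hr z
    have h2 := le_norm_recip_eval hp hr (z := z) (by rw [hz']; exact hrρ1.le)
    rw [hz'] at h1 h2
    have h3 : 0 < (1 - r * ρ⁻¹) ^ p.natDegree := pow_pos (by linarith) _
    calc ‖f z‖ = ‖p.eval z‖ / ‖(recip p).eval z‖ := norm_div _ _
      _ ≤ (ρ⁻¹ + r) ^ p.natDegree / (1 - r * ρ⁻¹) ^ p.natDegree := by gcongr
      _ = ((1 + r * ρ) / (ρ - r)) ^ p.natDegree := by
          rw [← div_pow]
          congr 1
          have : ρ - r ≠ 0 := by linarith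
          have : 1 - r * ρ⁻¹ ≠ 0 := by linarith
          field_simp
      _ ≤ (2 / (ρ - r)) ^ p.natDegree := by
          have : 0 < ρ - r := by linarith
          gcongr
          nlinarith
  refine ⟨fun j => ((j.factorial : ℂ))⁻¹ * iteratedDeriv j f 0, fun j => ?_, fun z hz => ?_⟩
  · have h1 := Complex.norm_iteratedDeriv_le_of_forall_mem_sphere_norm_le j
      (inv_pos.2 hρ0) hcl hbound
    have hj : (0 : ℝ) < j.factorial := by exact_mod_cast j.factorial_pos
    rw [norm_mul, norm_inv, Complex.norm_natCast, inv_mul_le_iff₀ hj]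
    refine h1.trans (le_of_eq ?_)
    rw [inv_pow, div_inv_eq_mul]
    ring
  · have hz1 : z ∈ Metric.ball (0 : ℂ) ρ⁻¹ := by
      rw [mem_ball_zero_iff]
      exact hz.trans_lt ((one_lt_inv₀ hρ0).2 hρ)
    have := Complex.hasSum_taylorSeries_on_ball hcl.differentiableOn hz1
    have h2 : (fun j : ℕ => (j.factorial : ℂ)⁻¹ * iteratedDeriv j f 0 * z ^ j)
        = fun j => (j.factorial : ℂ)⁻¹ • (z - 0) ^ j • iteratedDeriv j f 0 := by
      funext j
      simp only [sub_zero, smul_eq_mul]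
      ring
    exact h2 ▸ this

/-- The tail of a power series with geometrically decaying coefficients, with the factor `‖z‖ ^ N`
that makes it `O(z ^ N)` at the origin. -/
theorem norm_sub_sum_le {σ : ℕ → ℂ} {K : ℝ} (hK : 0 ≤ K) (hρ0 : 0 ≤ ρ) (hρ : ρ < 1)
    (hσ : ∀ j, ‖σ j‖ ≤ K * ρ ^ j) {z F : ℂ} (hz : ‖z‖ ≤ 1)
    (hF : HasSum (fun j => σ j * z ^ j) F) (N : ℕ) :
    ‖F - ∑ j ∈ Finset.range N, σ j * z ^ j‖ ≤ K / (1 - ρ) * ρ ^ N * ‖z‖ ^ N := by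
  have h1 : ∀ j, ‖σ j * z ^ j‖ ≤ K * (ρ * ‖z‖) ^ j := fun j => by
    rw [norm_mul, norm_pow, mul_pow, ← mul_assoc]
    gcongr
    exact hσ j
  have h2 : ρ * ‖z‖ ≤ ρ := mul_le_of_le_one_right hρ0 hz
  have h3 := norm_sub_le_of_geometric_bound_of_hasSum (h2.trans_lt hρ) h1 hF N
  rw [norm_sub_rev]
  refine h3.trans ?_
  have h4 : 0 < 1 - ρ := by linarith
  calc K * (ρ * ‖z‖) ^ N / (1 - ρ * ‖z‖) ≤ K * (ρ * ‖z‖) ^ N / (1 - ρ) := by gcongr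
    _ = K / (1 - ρ) * ρ ^ N * ‖z‖ ^ N := by rw [mul_pow]; ring

theorem eq_zero_of_eval_isBigO {A : ℂ[X]} {m : ℕ} (hA : A.natDegree ≤ m)
    (h : (fun z : ℂ => A.eval z) =O[𝓝 0] fun z : ℂ => z ^ (m + 1)) : A = 0 := by
  by_contra h0
  obtain ⟨B, hB, hdvd⟩ := Polynomial.exists_eq_pow_rootMultiplicity_mul_and_not_dvd A h0 0
  set k := A.rootMultiplicity 0
  rw [Polynomial.C_0, sub_zero] at hB hdvd
  have hB0 : B.eval 0 ≠ 0 := by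
    rwa [Polynomial.X_dvd_iff, Polynomial.coeff_zero_eq_eval_zero] at hdvd
  have hk : k ≤ m := by
    have h1 : B ≠ 0 := by rintro rfl; simp at hB0
    have h2 : A.natDegree = k + B.natDegree := by
      conv_lhs => rw [hB]
      rw [Polynomial.natDegree_mul (pow_ne_zero _ Polynomial.X_ne_zero) h1,
        Polynomial.natDegree_X_pow]
    omega
  obtain ⟨c, hc⟩ := h.bound
  have h1 : ∀ᶠ z : ℂ in 𝓝[≠] 0, ‖B.eval z‖ ≤ c * ‖z‖ ^ (m + 1 - k) := by
    filter_upwards [hc.filter_mono nhdsWithin_le_nhds, self_mem_nhdsWithin] with z hz hz0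
    have hz0' : 0 < ‖z‖ := norm_pos_iff.2 hz0
    have h2 : A.eval z = z ^ k * B.eval z := by
      conv_lhs => rw [hB]
      simp
    rw [h2, norm_mul, norm_pow, norm_pow, show m + 1 = k + (m + 1 - k) by omega, pow_add] at hz
    have h3 : 0 < ‖z‖ ^ k := pow_pos hz0' k
    have h4 : ‖z‖ ^ k * ‖B.eval z‖ ≤ ‖z‖ ^ k * (c * ‖z‖ ^ (m + 1 - k)) := by linarith
    exact le_of_mul_le_mul_left h4 h3
  have h2 : Tendsto (fun z : ℂ => ‖B.eval z‖) (𝓝[≠] 0) (𝓝 ‖B.eval 0‖) :=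
    (B.continuous.norm.tendsto 0).mono_left nhdsWithin_le_nhds
  have h3 : Tendsto (fun z : ℂ => c * ‖z‖ ^ (m + 1 - k)) (𝓝[≠] 0) (𝓝 0) := by
    have : Continuous fun z : ℂ => c * ‖z‖ ^ (m + 1 - k) := by fun_prop
    have h4 := (this.tendsto 0).mono_left (nhdsWithin_le_nhds (s := {0}ᶜ))
    simpa [show m + 1 - k ≠ 0 by omega] using h4
  have h5 := le_of_tendsto_of_tendsto h2 h3 h1
  exact hB0 (norm_le_zero_iff.1 h5)

theorem HasExpansion.eq_of_hasSum {m : ℕ} {τ σ : ℕ → ℂ} {K : ℝ} (hτ : HasExpansion p m τ)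
    (hK : 0 ≤ K) (hρ0 : 0 ≤ ρ) (hρ : ρ < 1) (hσ : ∀ j, ‖σ j‖ ≤ K * ρ ^ j)
    (hsum : ∀ z : ℂ, ‖z‖ ≤ 1 → HasSum (fun j => σ j * z ^ j) (p.eval z / (recip p).eval z))
    {j : ℕ} (hj : j ≤ m) : τ j = σ j := by
  have h1 : (fun z : ℂ => p.eval z / (recip p).eval z - ∑ j ∈ Finset.range (m + 1), σ j * z ^ j)
      =O[𝓝 0] (fun z : ℂ => z ^ (m + 1)) := by
    refine IsBigO.of_bound (K / (1 - ρ) * ρ ^ (m + 1)) ?_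
    filter_upwards [Metric.ball_mem_nhds (0 : ℂ) one_pos] with z hz
    rw [mem_ball_zero_iff] at hz
    rw [norm_pow]
    exact norm_sub_sum_le hK hρ0 hρ hσ hz.le (hsum z hz.le) (m + 1)
  set A : ℂ[X] := ∑ i ∈ Finset.range (m + 1), Polynomial.C (τ i - σ i) * Polynomial.X ^ i with hA
  have hA0 : A = 0 := by
    refine eq_zero_of_eval_isBigO (m := m) ?_ ?_
    · refine Polynomial.natDegree_sum_le_of_forall_le _ _ fun i hi => ?_
      exact (Polynomial.natDegree_C_mul_X_pow_le _ _).trans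
        (Nat.lt_succ_iff.1 (Finset.mem_range.1 hi))
    · refine (h1.sub hτ).congr_left fun z => ?_
      simp only [hA, Polynomial.eval_finsetSum, Polynomial.eval_mul, Polynomial.eval_C,
        Polynomial.eval_pow, Polynomial.eval_X, sub_mul, Finset.sum_sub_distrib]
      ring
  have h2 : A.coeff j = τ j - σ j := by
    rw [hA, Polynomial.finsetSum_coeff]
    simp only [Polynomial.coeff_C_mul, Polynomial.coeff_X_pow]
    simp [hj]
  rw [hA0, Polynomial.coeff_zero] at h2
  exact (sub_eq_zero.1 h2.symm)

end Taylor

/-! ### The maximum norm and the existence of minimizers -/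

section SupNorm

theorem continuous_circ : Continuous circ := by
  unfold circ
  fun_prop

theorem norm_circ (φ : ℝ) : ‖circ φ‖ = 1 := Complex.norm_exp_ofReal_mul_I φ

theorem exists_circ_eq {z : ℂ} (hz : ‖z‖ = 1) : ∃ φ ∈ Set.Icc (0 : ℝ) (2 * π), circ φ = z := by
  have hpi : (0 : ℝ) < 2 * π := by positivity
  refine ⟨toIcoMod hpi 0 z.arg, ?_, ?_⟩
  · have := toIcoMod_mem_Ico hpi 0 z.arg
    rw [zero_add] at this
    exact Set.Ico_subset_Icc_self this
  · have h1 : z.arg = toIcoMod hpi 0 z.arg + toIcoDiv hpi 0 z.arg • (2 * π) :=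
      (toIcoMod_add_toIcoDiv_zsmul hpi 0 z.arg).symm
    have h2 : circ z.arg = z := by
      have := Complex.norm_mul_exp_arg_mul_I z
      rwa [hz, Complex.ofReal_one, one_mul] at this
    conv_rhs => rw [← h2, h1]
    rw [circ, circ]
    push_cast
    rw [add_mul, zsmul_eq_mul, mul_assoc, Complex.exp_add,
      Complex.exp_int_mul_two_pi_mul_I, mul_one]

theorem continuous_trigPoly (n : ℕ) (c : ℕ → ℂ) : Continuous (trigPoly n c) := by
  unfold trigPoly
  have := continuous_circ
  fun_prop

theorem abs_le_supNorm {f : ℝ → ℝ} (hf : Continuous f) {φ : ℝ} (hφ : φ ∈ Set.Icc (0 : ℝ) (2 * π)) :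
    |f φ| ≤ supNorm f :=
  le_csSup (isCompact_Icc.image hf.abs).bddAbove ⟨φ, hφ, rfl⟩

theorem supNorm_le {f : ℝ → ℝ} {M : ℝ} (h : ∀ φ ∈ Set.Icc (0 : ℝ) (2 * π), |f φ| ≤ M) :
    supNorm f ≤ M := by
  refine csSup_le (Set.Nonempty.image _ ⟨0, by simp [Real.pi_pos.le]⟩) ?_
  rintro _ ⟨φ, hφ, rfl⟩
  exact h φ hφ

/-- The linear map that sends the coefficients of a trigonometric polynomial to its restriction to
`[0, 2π]`. -/
noncomputable def trigPolyLinear (n : ℕ) :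
    (Fin (n + 1) → ℂ) →ₗ[ℝ] C(Set.Icc (0 : ℝ) (2 * π), ℝ) where
  toFun c := ⟨fun φ => (∑ j : Fin (n + 1), c j * circ φ ^ (n - (j : ℕ))).re, by
    have := continuous_circ
    fun_prop⟩
  map_add' c d := by
    ext φ
    simp [add_mul, Finset.sum_add_distrib]
  map_smul' a c := by
    ext φ
    simp [mul_assoc]
    rw [← Finset.sum_sub_distrib, Finset.mul_sum]

theorem trigPolyLinear_apply (n : ℕ) (c : ℕ → ℂ) (φ : Set.Icc (0 : ℝ) (2 * π)) :
    trigPolyLinear n (fun j => c j) φ = trigPoly n c φ := by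
  simp only [trigPolyLinear, trigPoly, LinearMap.coe_mk, AddHom.coe_mk, ContinuousMap.coe_mk]
  rw [Finset.sum_range fun j => c j * circ φ ^ (n - j)]

theorem norm_trigPolyLinear (n : ℕ) (c : ℕ → ℂ) :
    ‖trigPolyLinear n (fun j => c j)‖ = supNorm (trigPoly n c) := by
  have h0 : (0 : ℝ) ∈ Set.Icc (0 : ℝ) (2 * π) := by simp [Real.pi_pos.le]
  refine le_antisymm ?_ ?_
  · refine (ContinuousMap.norm_le _
      ((abs_nonneg _).trans (abs_le_supNorm (continuous_trigPoly n c) h0))).2 fun φ => ?_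
    rw [trigPolyLinear_apply, Real.norm_eq_abs]
    exact abs_le_supNorm (continuous_trigPoly n c) φ.2
  · refine supNorm_le fun φ hφ => ?_
    have := (trigPolyLinear n (fun j => c j)).norm_coe_le_norm ⟨φ, hφ⟩
    rwa [trigPolyLinear_apply, Real.norm_eq_abs] at this

/-- Best approximation from a finite-dimensional subspace of a normed space. -/
theorem exists_norm_add_le {E : Type*} [NormedAddCommGroup E] [NormedSpace ℝ E]
    (S : Submodule ℝ E) [FiniteDimensional ℝ S] (x : E) :
    ∃ s ∈ S, ∀ s' ∈ S, ‖x + s‖ ≤ ‖x + s'‖ := by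
  set W : Submodule ℝ E := S ⊔ ℝ ∙ x
  have : ProperSpace W := FiniteDimensional.proper ℝ W
  have hx : -x ∈ W := W.neg_mem (Submodule.mem_sup_right (Submodule.mem_span_singleton_self x))
  have hclosed : IsClosed ((↑) ⁻¹' (S : Set E) : Set W) :=
    S.closed_of_finiteDimensional.preimage continuous_subtype_val
  obtain ⟨y, hy, hdist⟩ := hclosed.exists_infDist_eq_dist ⟨0, S.zero_mem⟩ ⟨-x, hx⟩
  refine ⟨y, hy, fun s' hs' => ?_⟩
  have h1 := Metric.infDist_le_dist_of_mem (x := (⟨-x, hx⟩ : W))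
    (show (⟨s', Submodule.mem_sup_left hs'⟩ : W) ∈ ((↑) ⁻¹' (S : Set E) : Set W) from hs')
  rw [hdist, Subtype.dist_eq, Subtype.dist_eq, dist_comm, dist_comm (-x), dist_eq_norm,
    dist_eq_norm, sub_neg_eq_add, sub_neg_eq_add, add_comm, add_comm s'] at h1
  exact h1

theorem exists_isZolotarev (n k : ℕ) (c : ℕ → ℂ) : ∃ Z, IsZolotarev n k c Z := by
  set V : Submodule ℝ (Fin (n + 1) → ℂ) :=
    { carrier := {d | ∀ j : Fin (n + 1), (j : ℕ) ≤ k → d j = 0}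
      add_mem' := fun ha hb j hj => by simp [ha j hj, hb j hj]
      zero_mem' := fun j _ => rfl
      smul_mem' := fun a d hd j hj => by simp [hd j hj] } with hV
  obtain ⟨s, hs, hmin⟩ := exists_norm_add_le (V.map (trigPolyLinear n))
    (trigPolyLinear n fun j => c j)
  obtain ⟨v, hv, rfl⟩ := hs
  have hv' : ∀ j : Fin (n + 1), (j : ℕ) ≤ k → v j = 0 := hv
  set d : ℕ → ℂ := fun j => c j + if h : j < n + 1 then v ⟨j, h⟩ else 0 with hd
  have hd1 : ∀ j ≤ k, d j = c j := fun j hj => by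
    simp only [hd]
    split_ifs with h
    · rw [hv' ⟨j, h⟩ hj, add_zero]
    · rw [add_zero]
  have hd2 : (trigPolyLinear n fun j => d j)
      = (trigPolyLinear n fun j => c j) + trigPolyLinear n v := by
    rw [← map_add]
    congr 1
    ext j
    simp only [hd, Pi.add_apply, j.isLt, dif_pos]
  refine ⟨trigPoly n d, ⟨d, hd1, rfl⟩, fun d' hd' => ?_⟩
  rw [← norm_trigPolyLinear, ← norm_trigPolyLinear, hd2]
  have hw : (fun j : Fin (n + 1) => d' j - c j) ∈ V := fun j hj => by
    simp [hd' j hj]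
  refine (hmin _ (Submodule.mem_map_of_mem hw)).trans (le_of_eq ?_)
  rw [← map_add]
  congr 2
  ext j
  simp

end SupNorm

/-! ### The Zolotarev polynomials -/

section Estimate

variable {p : ℂ[X]} {r ρ : ℝ}

theorem conj_phase (hr : ∀ z, p.IsRoot z → ‖z‖ ≤ r) (hr1 : r < 1) (n : ℕ) {z : ℂ}
    (hz : ‖z‖ = 1) : conj (phase p n z) = (z ^ n)⁻¹ * (p.eval z / (recip p).eval z) := by
  have h1 : conj (phase p n z) = (phase p n z)⁻¹ := by
    rw [Complex.inv_def, Complex.normSq_eq_norm_sq, norm_phase_of_norm_eq_one hr hr1 n hz]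
    simp
  rw [h1, phase, mul_inv, inv_div]

theorem trigPoly_conj (n : ℕ) (σ : ℕ → ℂ) (φ : ℝ) :
    trigPoly n (fun j => conj (σ j)) φ
      = ((circ φ ^ n)⁻¹ * ∑ j ∈ Finset.range (n + 1), σ j * circ φ ^ j).re := by
  have h0 : circ φ ≠ 0 := Complex.exp_ne_zero _
  have h1 : conj (circ φ) = (circ φ)⁻¹ := by
    rw [Complex.inv_def, Complex.normSq_eq_norm_sq, norm_circ]
    simp
  rw [trigPoly, ← Complex.conj_re, map_sum, Finset.mul_sum]
  congr 1
  refine Finset.sum_congr rfl fun j hj => ?_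
  obtain ⟨i, rfl⟩ := Nat.exists_eq_add_of_le (Nat.lt_succ_iff.1 (Finset.mem_range.1 hj))
  rw [map_mul, Complex.conj_conj, map_pow, h1, Nat.add_sub_cancel_left, pow_add,
    inv_pow]
  field_simp

theorem abs_phase_re_sub_trigPoly_le (hr : ∀ z, p.IsRoot z → ‖z‖ ≤ r) (hr1 : r < 1)
    {σ : ℕ → ℂ} {K : ℝ} (hK : 0 ≤ K) (hρ0 : 0 ≤ ρ) (hρ : ρ < 1) (hσ : ∀ j, ‖σ j‖ ≤ K * ρ ^ j)
    (hsum : ∀ z : ℂ, ‖z‖ ≤ 1 → HasSum (fun j => σ j * z ^ j) (p.eval z / (recip p).eval z))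
    (n : ℕ) (φ : ℝ) :
    |(phase p n (circ φ)).re - trigPoly n (fun j => conj (σ j)) φ| ≤ K / (1 - ρ) * ρ ^ n := by
  have hz := norm_circ φ
  rw [trigPoly_conj, ← Complex.conj_re (phase p n (circ φ)), conj_phase hr hr1 n hz,
    ← Complex.sub_re, ← mul_sub]
  refine (Complex.abs_re_le_norm _).trans ?_
  rw [norm_mul, norm_inv, norm_pow, hz, one_pow, inv_one, one_mul]
  refine (norm_sub_sum_le hK hρ0 hρ hσ hz.le (hsum _ hz.le) (n + 1)).trans ?_
  rw [hz, one_pow, mul_one]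
  have h1 : ρ ^ (n + 1) ≤ ρ ^ n := pow_le_pow_of_le_one hρ0 hρ.le (Nat.le_succ n)
  have h2 : 0 < 1 - ρ := by linarith
  gcongr

/-- Two trigonometric polynomials with the same leading coefficients differ by one of lower
degree. -/
theorem trigPoly_sub_trigPoly {n D k : ℕ} (hn : n ≤ k + D + 1) (hD : D ≤ n) {c d : ℕ → ℂ}
    (h : ∀ j ≤ k, c j = d j) (φ : ℝ) :
    trigPoly n c φ - trigPoly n d φ
      = (∑ i ∈ Finset.range (D + 1), (c (n - i) - d (n - i)) * circ φ ^ i).re := by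
  rw [trigPoly, trigPoly, ← Complex.sub_re, ← Finset.sum_sub_distrib]
  congr 1
  rw [← Finset.sum_flip]
  symm
  refine Eq.trans ?_ (Finset.sum_subset
    (Finset.range_mono (Nat.succ_le_succ hD)) fun i hi hi' => ?_)
  · refine Finset.sum_congr rfl fun i hi => ?_
    have := Finset.mem_range.1 hi
    rw [Nat.sub_sub_self (by omega), sub_mul]
  · simp only [Finset.mem_range, not_lt] at hi hi'
    rw [h _ (by omega), sub_self]

/-- The estimates for a fixed bound `r` on the roots, with a constant that does not depend on the
polynomial. -/
theorem exists_zolotarev_estimate (l : ℕ) {r r' : ℝ} (hr0 : 0 ≤ r) (hrr' : r < r') (hr1 : r' < 1) :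
    ∃ C : ℝ, 0 ≤ C ∧ ∀ (p : ℂ[X]) (m : ℕ) (τ : ℕ → ℂ) (k n : ℕ) (Z : ℝ → ℝ),
      p.Monic → p.natDegree = l → (∀ z, p.IsRoot z → ‖z‖ ≤ r) → HasExpansion p m τ →
      l ≤ k → k ≤ m → IsZolotarev n k (fun j => starRingEnd ℂ (τ j)) Z →
      (∀ φ ∈ Set.Icc (0 : ℝ) (2 * π), |Z φ - blaschkeRe p n φ| ≤ C * r' ^ n) ∧
        |supNorm Z - 1| ≤ C * r' ^ n := by
  obtain ⟨ρ, hrρ, hρr'⟩ := exists_between hrr'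
  have hρ0 : 0 < ρ := hr0.trans_lt hrρ
  have hρ1 : ρ < 1 := hρr'.trans hr1
  have hr'0 : 0 < r' := hρ0.trans hρr'
  set K : ℝ := (2 / (ρ - r)) ^ l with hK
  have hK0 : 0 ≤ K := pow_nonneg (div_nonneg (by norm_num) (by linarith)) _
  set η : ℝ := K / (1 - ρ) with hη
  have hη0 : 0 ≤ η := div_nonneg hK0 (by linarith)
  set S : ℝ := stabConst l r ρ with hS
  have hS0 : 0 ≤ S := by
    have : 0 < 1 - r := by linarith
    rw [hS, stabConst, errConst]
    positivity
  have hpow : Tendsto (fun n : ℕ => ρ ^ n) atTop (𝓝 0) :=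
    tendsto_pow_atTop_nhds_zero_of_lt_one hρ0.le hρ1
  obtain ⟨n₀, hn₀⟩ : ∃ n₀ : ℕ, ∀ n ≥ n₀, K * ρ ^ n ≤ 1 / 2 ∧ 2 * η * ρ ^ n ≤ 1 ∧ l < n := by
    have h1 : ∀ᶠ n : ℕ in atTop, K * ρ ^ n ≤ 1 / 2 := by
      have := hpow.const_mul K
      rw [mul_zero] at this
      exact this.eventually_le_const (by norm_num)
    have h2 : ∀ᶠ n : ℕ in atTop, 2 * η * ρ ^ n ≤ 1 := by
      have := hpow.const_mul (2 * η)
      rw [mul_zero] at this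
      exact this.eventually_le_const (by norm_num)
    exact eventually_atTop.1 (h1.and (h2.and (eventually_gt_atTop l)))
  -- the factor `n` in the stability estimate is absorbed by passing from `ρ` to `r'`
  obtain ⟨M, hM0, hM⟩ : ∃ M : ℝ, 0 ≤ M ∧ ∀ n : ℕ, n * ρ ^ n ≤ M * r' ^ n := by
    have h1 : Tendsto (fun n : ℕ => (n : ℝ) * (ρ / r') ^ n) atTop (𝓝 0) :=
      tendsto_self_mul_const_pow_of_lt_one (by positivity) ((div_lt_one hr'0).2 hρr')
    obtain ⟨M, hM⟩ := h1.bddAbove_range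
    refine ⟨M, by simpa using hM ⟨0, rfl⟩, fun n => ?_⟩
    have h2 : (n : ℝ) * (ρ / r') ^ n ≤ M := hM ⟨n, rfl⟩
    rwa [div_pow, ← mul_div_assoc, div_le_iff₀ (by positivity)] at h2
  set A : ℝ := (2 * (S * (2 * η + 1)) + η) * M with hA
  have hA0 : 0 ≤ A := by positivity
  have hB0 : 0 ≤ (2 + η) / r' ^ n₀ := by positivity
  refine ⟨A + η + (2 + η) / r' ^ n₀, by positivity, ?_⟩
  intro p m τ k n Z hp hpl hroots hτ hlk hkm hZ
  have hr1' : r < 1 := hrρ.trans hρ1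
  obtain ⟨σ, hσ, hsum⟩ := exists_taylor hp hroots hr0 hrρ hρ1
  rw [hpl, ← hK] at hσ
  set T : ℝ → ℝ := trigPoly n fun j => conj (σ j) with hT
  have hτσ : ∀ j ≤ k, conj (τ j) = conj (σ j) := fun j hj => by
    rw [hτ.eq_of_hasSum hK0 hρ0.le hρ1 hσ hsum (hj.trans hkm)]
  have hTu : ∀ φ, |(phase p n (circ φ)).re - T φ| ≤ η * ρ ^ n :=
    abs_phase_re_sub_trigPoly_le hroots hr1' hK0 hρ0.le hρ1 hσ hsum n
  have hu : ∀ φ, |(phase p n (circ φ)).re| ≤ 1 := fun φ =>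
    (Complex.abs_re_le_norm _).trans (norm_phase_of_norm_eq_one hroots hr1' n (norm_circ φ)).le
  have hTsup : supNorm T ≤ 1 + η * ρ ^ n := supNorm_le fun φ _ => by
    have h1 := abs_le.1 (hTu φ)
    have h2 := abs_le.1 (hu φ)
    rw [abs_le]
    constructor <;> linarith
  obtain ⟨⟨d, hd, rfl⟩, hmin⟩ := hZ
  have hZsup : supNorm (trigPoly n d) ≤ 1 + η * ρ ^ n :=
    (hmin (fun j => conj (σ j)) fun j hj => (hτσ j hj).symm).trans hTsup
  have hZle : ∀ φ ∈ Set.Icc (0 : ℝ) (2 * π), |trigPoly n d φ| ≤ 1 + η * ρ ^ n := fun φ hφ =>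
    (abs_le_supNorm (continuous_trigPoly n d) hφ).trans hZsup
  have hZsup0 : 0 ≤ supNorm (trigPoly n d) :=
    (abs_nonneg _).trans (abs_le_supNorm (continuous_trigPoly n d)
      (φ := 0) (by simp [Real.pi_pos.le]))
  have hρn : ρ ^ n ≤ 1 := pow_le_one₀ hρ0.le hρ1.le
  have hρn0 : 0 < ρ ^ n := pow_pos hρ0 n
  have hρr : ρ ^ n ≤ r' ^ n := pow_le_pow_left₀ hρ0.le hρr'.le n
  have hr'n0 : 0 < r' ^ n := pow_pos hr'0 n
  have hηn : η * ρ ^ n ≤ η := mul_le_of_le_one_right hη0 hρn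
  rcases lt_or_ge n n₀ with hn | hn
  · have h1 : 2 + η ≤ (2 + η) / r' ^ n₀ * r' ^ n := by
      rw [div_mul_eq_mul_div, le_div_iff₀ (by positivity)]
      have : r' ^ n₀ ≤ r' ^ n := pow_le_pow_of_le_one hr'0.le hr1.le hn.le
      gcongr
    have h2 : 2 + η ≤ (A + η + (2 + η) / r' ^ n₀) * r' ^ n := by
      have h3 : 0 ≤ (A + η) * r' ^ n := by positivity
      linarith [add_mul (A + η) ((2 + η) / r' ^ n₀) (r' ^ n)]
    refine ⟨fun φ hφ => le_trans ?_ h2, le_trans ?_ h2⟩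
    · have h3 := abs_le.1 (hZle φ hφ)
      have h4 := abs_le.1 (hu φ)
      rw [blaschkeRe_eq, abs_le]
      constructor <;> linarith
    · rw [abs_le]
      constructor <;> linarith
  · obtain ⟨hs1, hs2, hs3⟩ := hn₀ n hn
    have dd : PhaseSmall p r ρ n := ⟨hp, hroots, hr0, hrρ, hρ1, by rwa [hpl]⟩
    obtain ⟨D, hD⟩ : ∃ D, n = l + (D + 1) := ⟨n - l - 1, by omega⟩
    have hdiff : ∀ φ, trigPoly n d φ - T φ
        = (∑ i ∈ Finset.range (D + 1), (d (n - i) - conj (σ (n - i))) * circ φ ^ i).re :=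
      trigPoly_sub_trigPoly (k := k) (by omega) (by omega)
        fun j hj => (hd j hj).trans (hτσ j hj)
    have hcore : ∀ z : ℂ, ‖z‖ = 1 → |(phase p n z).re
        + (∑ i ∈ Finset.range (D + 1), (d (n - i) - conj (σ (n - i))) * z ^ i).re|
        ≤ 1 + 2 * η * ρ ^ n := by
      intro z hz
      obtain ⟨φ, hφ, rfl⟩ := exists_circ_eq hz
      rw [← hdiff φ]
      have h1 := abs_le.1 (hTu φ)
      have h2 := abs_le.1 (hZle φ hφ)
      rw [abs_le]
      constructor <;> linarith
    have hdist : ∀ φ, |trigPoly n d φ - blaschkeRe p n φ| ≤ A * r' ^ n := by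
      intro φ
      have h1 := dd.abs_re_sum_le (by rw [hpl]; exact hD) _ (by positivity) hs2 hcore (norm_circ φ)
      rw [← hdiff φ, hpl, ← hS] at h1
      have h2 := hTu φ
      have hn1 : (1 : ℝ) ≤ n := by
        have : 1 ≤ n := by omega
        exact_mod_cast this
      calc |trigPoly n d φ - blaschkeRe p n φ|
          ≤ |trigPoly n d φ - T φ| + |(phase p n (circ φ)).re - T φ| := by
            rw [blaschkeRe_eq, abs_sub_comm (phase p n (circ φ)).re]
            exact abs_sub_le _ _ _
        _ ≤ 2 * n * (S * (2 * η * ρ ^ n + ρ ^ n)) + n * (η * ρ ^ n) := by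
            refine add_le_add h1 (h2.trans ?_)
            exact le_mul_of_one_le_left (by positivity) hn1
        _ = (2 * (S * (2 * η + 1)) + η) * (n * ρ ^ n) := by ring
        _ ≤ (2 * (S * (2 * η + 1)) + η) * (M * r' ^ n) := by
            have := hM n
            gcongr
        _ = A * r' ^ n := by rw [hA]; ring
    have hle : A * r' ^ n ≤ (A + η + (2 + η) / r' ^ n₀) * r' ^ n := by
      gcongr
      linarith
    refine ⟨fun φ _ => (hdist φ).trans hle, ?_⟩
    obtain ⟨z, hz, hz1⟩ := exists_abs_re_phase_eq_one hroots hr1' (n := n) (by omega)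
    obtain ⟨φ, hφ, rfl⟩ := exists_circ_eq hz
    have h1 : 1 - A * r' ^ n ≤ supNorm (trigPoly n d) := by
      have h2 := hdist φ
      have h3 := abs_le_supNorm (continuous_trigPoly n d) hφ
      rw [blaschkeRe_eq, abs_sub_comm] at h2
      have h4 := abs_sub_abs_le_abs_sub (phase p n (circ φ)).re (trigPoly n d φ)
      linarith
    have h2 : η * ρ ^ n ≤ (A + η + (2 + η) / r' ^ n₀) * r' ^ n := by
      have : η ≤ A + η + (2 + η) / r' ^ n₀ := by linarith
      gcongr
    rw [abs_le]
    constructor <;> linarith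

theorem eval_sub_eval_of_monic {l : ℕ} {P : ℂ[X]} (hp : p.Monic) (hpl : p.natDegree = l)
    (hP : P.Monic) (hPl : P.natDegree = l) (z : ℂ) :
    P.eval z - p.eval z = ∑ i ∈ Finset.range l, (P.coeff i - p.coeff i) * z ^ i := by
  have h4 : P.coeff l = 1 := by rw [← hPl]; exact hP.coeff_natDegree
  have h5 : p.coeff l = 1 := by rw [← hpl]; exact hp.coeff_natDegree
  rw [Polynomial.eval_eq_sum_range, Polynomial.eval_eq_sum_range, hPl, hpl,
    Finset.sum_range_succ, Finset.sum_range_succ, h4, h5]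
  simp only [sub_mul, Finset.sum_sub_distrib]
  ring

/-- If `p` has its roots in `|z| ≤ r`, then the roots of the nearby monic polynomials of the same
degree lie in any larger disc. -/
theorem eventually_roots_le {l : ℕ} {P : ℕ → ℂ[X]} (hp : p.Monic) (hpl : p.natDegree = l)
    (hP : ∀ ν, (P ν).Monic ∧ (P ν).natDegree = l)
    (hlim : ∀ i, Tendsto (fun ν => (P ν).coeff i) atTop (𝓝 (p.coeff i)))
    (hr : ∀ z, p.IsRoot z → ‖z‖ ≤ r) (hr0 : 0 ≤ r) (hrρ : r < ρ) (hρ : ρ < 1) :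
    ∀ᶠ ν in atTop, ∀ z, (P ν).IsRoot z → ‖z‖ ≤ ρ := by
  have hρ0 : 0 < ρ := hr0.trans_lt hrρ
  have hsum : Tendsto (fun ν => ∑ i ∈ Finset.range l, ‖(P ν).coeff i - p.coeff i‖) atTop (𝓝 0) := by
    have : Tendsto (fun ν => ∑ i ∈ Finset.range l, ‖(P ν).coeff i - p.coeff i‖) atTop
        (𝓝 (∑ i ∈ Finset.range l, ‖p.coeff i - p.coeff i‖)) :=
      tendsto_finsetSum _ fun i _ => ((hlim i).sub_const _).norm
    simpa using this
  have hpos : 0 < (ρ - r) ^ l := pow_pos (by linarith) _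
  filter_upwards [hsum.eventually_lt_const hpos] with ν hν z hz
  by_contra! hlt
  have hz0 : 0 < ‖z‖ := hρ0.trans hlt
  have hzρ : 1 ≤ ‖z‖ / ρ := (one_le_div hρ0).2 hlt.le
  have h1 := le_norm_eval hp hr (hrρ.trans hlt).le
  rw [hpl] at h1
  have h2 := eval_sub_eval_of_monic hp hpl (hP ν).1 (hP ν).2 z
  rw [show (P ν).eval z = 0 from hz, zero_sub] at h2
  -- both sides are compared with `(‖z‖ / ρ) ^ l`
  have h3 : ‖p.eval z‖ ≤ (∑ i ∈ Finset.range l, ‖(P ν).coeff i - p.coeff i‖) * (‖z‖ / ρ) ^ l := by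
    rw [← norm_neg, h2, Finset.sum_mul]
    refine norm_sum_le_of_le _ fun i hi => ?_
    rw [norm_mul, norm_pow]
    gcongr
    calc ‖z‖ ^ i = ρ ^ i * (‖z‖ / ρ) ^ i := by rw [← mul_pow, mul_div_cancel₀ _ hρ0.ne']
      _ ≤ 1 * (‖z‖ / ρ) ^ l := by
          have h5 : ρ ^ i ≤ 1 := pow_le_one₀ hρ0.le hρ.le
          have h6 : (‖z‖ / ρ) ^ i ≤ (‖z‖ / ρ) ^ l :=
            pow_le_pow_right₀ hzρ (Finset.mem_range.1 hi).le
          gcongr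
      _ = (‖z‖ / ρ) ^ l := one_mul _
  have h4 : (ρ - r) ^ l * (‖z‖ / ρ) ^ l ≤ (‖z‖ - r) ^ l := by
    rw [← mul_pow]
    have h5 : (ρ - r) * (‖z‖ / ρ) = ‖z‖ - r * (‖z‖ / ρ) := by field_simp
    have h6 : 0 ≤ (ρ - r) * (‖z‖ / ρ) := mul_nonneg (by linarith) (by positivity)
    refine pow_le_pow_left₀ h6 ?_ l
    rw [h5]
    nlinarith
  have h5 : 0 < (‖z‖ / ρ) ^ l := by positivity
  exact absurd (le_of_mul_le_mul_right (h4.trans (h1.trans h3)) h5) (not_le.2 hν)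

theorem abs_blaschkeRe_sub_le {l : ℕ} {P : ℂ[X]} (hp : p.Monic) (hpl : p.natDegree = l)
    (hP : P.Monic) (hPl : P.natDegree = l) (hr : ∀ z, p.IsRoot z → ‖z‖ ≤ r)
    (hr' : ∀ z, P.IsRoot z → ‖z‖ ≤ r) (hr1 : r < 1) (n : ℕ) (φ : ℝ) :
    |blaschkeRe P n φ - blaschkeRe p n φ|
      ≤ 2 / (1 - r) ^ l * ∑ i ∈ Finset.range l, ‖P.coeff i - p.coeff i‖ := by
  set δ := ∑ i ∈ Finset.range l, ‖P.coeff i - p.coeff i‖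
  rw [blaschkeRe_eq, blaschkeRe_eq]
  set z := circ φ
  have hz : ‖z‖ = 1 := norm_circ φ
  have h0 : z ≠ 0 := Complex.exp_ne_zero _
  have hp0 : p.eval z ≠ 0 := eval_ne_zero_of_lt hr (by rw [hz]; exact hr1)
  have hP0 : P.eval z ≠ 0 := eval_ne_zero_of_lt hr' (by rw [hz]; exact hr1)
  have hδ : ‖P.eval z - p.eval z‖ ≤ δ := by
    rw [eval_sub_eval_of_monic hp hpl hP hPl]
    refine norm_sum_le_of_le _ fun i _ => ?_
    rw [norm_mul, norm_pow, hz, one_pow, mul_one]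
  have hlow : (1 - r) ^ l ≤ ‖p.eval z‖ := by
    have := le_norm_eval hp hr (z := z) (by rw [hz]; exact hr1.le)
    rwa [hz, hpl] at this
  have hr0 : 0 < (1 - r) ^ l := pow_pos (by linarith) _
  have hδ0 : 0 ≤ δ := (norm_nonneg _).trans hδ
  have key : phase P n z - phase p n z = z ^ n * z ^ l * ((conj (P.eval z) * (p.eval z - P.eval z)
      + P.eval z * conj (P.eval z - p.eval z)) / (P.eval z * p.eval z)) := by
    rw [phase, phase, recip_eval_of_norm_eq_one p hz, recip_eval_of_norm_eq_one P hz, hpl, hPl,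
      map_sub]
    field_simp
    ring
  rw [← Complex.sub_re]
  refine (Complex.abs_re_le_norm _).trans ?_
  rw [key, norm_mul, norm_mul, norm_pow, norm_pow, hz, one_pow, one_pow, one_mul, one_mul,
    norm_div, norm_mul]
  have hP1 : 0 < ‖P.eval z‖ := norm_pos_iff.2 hP0
  have hp1 : 0 < ‖p.eval z‖ := norm_pos_iff.2 hp0
  rw [div_le_iff₀ (by positivity)]
  calc ‖conj (P.eval z) * (p.eval z - P.eval z) + P.eval z * conj (P.eval z - p.eval z)‖
      ≤ ‖P.eval z‖ * δ + ‖P.eval z‖ * δ := by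
        refine (norm_add_le _ _).trans ?_
        rw [norm_mul, norm_mul, Complex.norm_conj, Complex.norm_conj, norm_sub_rev (p.eval z)]
        gcongr
    _ = 2 / (1 - r) ^ l * δ * (‖P.eval z‖ * (1 - r) ^ l) := by field_simp; ring
    _ ≤ 2 / (1 - r) ^ l * δ * (‖P.eval z‖ * ‖p.eval z‖) := by gcongr

/-- All roots lie in a disc smaller than a given disc that contains each of them. -/
theorem exists_lt_forall_root_le (hp : p.Monic) {s : ℝ} (hs : 0 < s)
    (h : ∀ z, p.IsRoot z → ‖z‖ < s) : ∃ r, 0 ≤ r ∧ r < s ∧ ∀ z, p.IsRoot z → ‖z‖ ≤ r := by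
  have hle : p.roots.toFinset.sup (fun z => ‖z‖₊) < (⟨s, hs.le⟩ : NNReal) := by
    refine (Finset.sup_lt_iff (show (⊥ : NNReal) < (⟨s, hs.le⟩ : NNReal) from hs)).2 fun z hz => ?_
    exact h z (Polynomial.isRoot_of_mem_roots (Multiset.mem_toFinset.1 hz))
  refine ⟨(p.roots.toFinset.sup (fun z => ‖z‖₊) : NNReal), NNReal.coe_nonneg _, hle, fun z hz => ?_⟩
  have : ‖z‖₊ ≤ p.roots.toFinset.sup (fun z => ‖z‖₊) := Finset.le_sup (f := fun z : ℂ => ‖z‖₊)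
    (Multiset.mem_toFinset.2 ((Polynomial.mem_roots hp.ne_zero).2 hz))
  exact this

end Estimate

end Zolotarev

theorem theorem1 :
    -- a fixed polynomial `p`
    (∀ (l m : ℕ) (p : ℂ[X]) (τ : ℕ → ℂ),
      l ≤ m → p.Monic → p.natDegree = l → (∀ z : ℂ, p.IsRoot z → ‖z‖ < 1) →
      Zolotarev.HasExpansion p m τ →
      ∀ r' : ℝ, 0 < r' → (∀ z : ℂ, p.IsRoot z → ‖z‖ < r') →
      ∃ C : ℝ, ∀ k n : ℕ, l ≤ k → k ≤ m → k ≤ n →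
        (∃ Z : ℝ → ℝ, Zolotarev.IsZolotarev n k (fun j => starRingEnd ℂ (τ j)) Z) ∧
        ∀ Z : ℝ → ℝ, Zolotarev.IsZolotarev n k (fun j => starRingEnd ℂ (τ j)) Z →
          (∀ φ ∈ Set.Icc (0 : ℝ) (2 * Real.pi),
            |Z φ - Zolotarev.blaschkeRe p n φ| ≤ C * r' ^ n) ∧
          |Zolotarev.supNorm Z - 1| ≤ C * r' ^ n) ∧
    -- polynomials `P ν` that vary with `n = N ν` and converge to `p`
    (∀ (l m : ℕ) (N : ℕ → ℕ) (P : ℕ → ℂ[X]) (p : ℂ[X]) (τ : ℕ → ℕ → ℂ) (r : ℝ),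
      l ≤ m → StrictMono N →
      (∀ ν, (P ν).Monic ∧ (P ν).natDegree = l) → p.Monic → p.natDegree = l →
      (∀ i, Tendsto (fun ν => (P ν).coeff i) atTop (𝓝 (p.coeff i))) →
      0 ≤ r → r < 1 → (∀ z : ℂ, p.IsRoot z → ‖z‖ ≤ r) →
      (∀ ν, Zolotarev.HasExpansion (P ν) m (τ ν)) →
      ∀ r' : ℝ, r < r' →
      ∃ C : ℝ, ∀ᶠ ν in atTop, ∀ k : ℕ, l ≤ k → k ≤ m →
        (∃ Z : ℝ → ℝ, Zolotarev.IsZolotarev (N ν) k (fun j => starRingEnd ℂ (τ ν j)) Z) ∧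
        ∀ Z : ℝ → ℝ, Zolotarev.IsZolotarev (N ν) k (fun j => starRingEnd ℂ (τ ν j)) Z →
          (∀ φ ∈ Set.Icc (0 : ℝ) (2 * Real.pi),
            |Z φ - Zolotarev.blaschkeRe (P ν) (N ν) φ| ≤ C * r' ^ N ν ∧
            |Z φ - Zolotarev.blaschkeRe p (N ν) φ| ≤
              C * (r' ^ N ν + ∑ i ∈ Finset.range l, ‖(P ν).coeff i - p.coeff i‖)) ∧
          |Zolotarev.supNorm Z - 1| ≤ C * r' ^ N ν) := by
  constructor
  · intro l m p τ _ hp hpl hroots hτ r' hr'0 hr'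
    obtain ⟨r, hr0, hr1, hr⟩ := Zolotarev.exists_lt_forall_root_le hp (lt_min hr'0 one_pos)
      fun z hz => lt_min (hr' z hz) (hroots z hz)
    obtain ⟨s, hrs, hs⟩ := exists_between hr1
    obtain ⟨C, hC0, hC⟩ := Zolotarev.exists_zolotarev_estimate l hr0 hrs
      (hs.trans_le (min_le_right _ _))
    refine ⟨C, fun k n hlk hkm _ => ⟨Zolotarev.exists_isZolotarev _ _ _, fun Z hZ => ?_⟩⟩
    obtain ⟨h1, h2⟩ := hC p m τ k n Z hp hpl hr hτ hlk hkm hZ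
    have h3 : C * s ^ n ≤ C * r' ^ n := by
      have : s ≤ r' := (hs.trans_le (min_le_left _ _)).le
      have : 0 ≤ s := hr0.trans hrs.le
      gcongr
    exact ⟨fun φ hφ => (h1 φ hφ).trans h3, h2.trans h3⟩
  · intro l m N P p τ r _ _ hP hp hpl hlim hr0 hr1 hr hτ r' hr'
    obtain ⟨ρ, hrρ, hρ⟩ := exists_between (lt_min hr' hr1)
    obtain ⟨s, hρs, hs⟩ := exists_between hρ
    have hρ1 : ρ < 1 := hρ.trans_le (min_le_right _ _)
    have hρ0 : 0 ≤ ρ := hr0.trans hrρ.le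
    obtain ⟨C, hC0, hC⟩ := Zolotarev.exists_zolotarev_estimate l hρ0 hρs
      (hs.trans_le (min_le_right _ _))
    have hc : 0 ≤ 2 / (1 - ρ) ^ l := div_nonneg (by norm_num) (pow_nonneg (by linarith) _)
    refine ⟨C + 2 / (1 - ρ) ^ l, ?_⟩
    filter_upwards [Zolotarev.eventually_roots_le hp hpl hP hlim hr hr0 hrρ hρ1] with ν hν k hlk hkm
    refine ⟨Zolotarev.exists_isZolotarev _ _ _, fun Z hZ => ?_⟩
    obtain ⟨h1, h2⟩ := hC (P ν) m (τ ν) k (N ν) Z (hP ν).1 (hP ν).2 hν (hτ ν) hlk hkm hZ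
    have hsr : s ^ N ν ≤ r' ^ N ν :=
      pow_le_pow_left₀ (hρ0.trans hρs.le) (hs.trans_le (min_le_left _ _)).le _
    have hr'0 : 0 ≤ r' ^ N ν := pow_nonneg (hr0.trans hr'.le) _
    have h3 : C * s ^ N ν ≤ (C + 2 / (1 - ρ) ^ l) * r' ^ N ν := by
      have : C ≤ C + 2 / (1 - ρ) ^ l := by linarith
      have : 0 ≤ s ^ N ν := pow_nonneg (hρ0.trans hρs.le) _
      gcongr
    refine ⟨fun φ hφ => ⟨(h1 φ hφ).trans h3, ?_⟩, h2.trans h3⟩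
    have h4 := Zolotarev.abs_blaschkeRe_sub_le hp hpl (hP ν).1 (hP ν).2
      (fun z hz => (hr z hz).trans hrρ.le) hν hρ1 (N ν) φ
    have h5 := (abs_sub_le _ _ _).trans (add_le_add (h1 φ hφ) h4)
    refine h5.trans ?_
    rw [mul_add]
    refine add_le_add h3 ?_
    have : 2 / (1 - ρ) ^ l ≤ C + 2 / (1 - ρ) ^ l := by linarith
    gcongr
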